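/- Let $d\ge 1$ and let $\mathbb S^d\subset\mathbb R^{d+1}$ be the round unit sphere, with surface area $|\mathbb S^d|$. The Laplace--Beltrami operator $-\Delta$ on $\mathbb S^d$ has eigenvalues $\lambda_1\le\lambda_2\le\cdots\nearrow+\infty$, listed with multiplicity, i.e. each real $\mu$ occurs as often as the dimension of the space of smooth real functions $u$ on $\mathbb S^d$ with $-\Delta u=\mu u$. Put $$R_1(z)=\sum_{j\ge1}(z-\lambda_j)_+,\qquad L^{class}_{1,d}=(4\pi)^{-d/2}\,\frac{\Gamma(2)}{\Gamma(2+d/2)},\qquad z_d=\frac{(2d-1)d}{12},$$ and let $\omega_d$ be the volume of the unit ball of $\mathbb R^d$. Then: 1. (Riesz means) For all $z\ge 0$, $$R_1(z)\le L^{class}_{1,d}\,|\mathbb S^d|\,(z+z_d)^{\frac d2+1}.$$ 2. (Eigenvalue averages) For all integers $k\ge 1$, $$\frac1k\sum_{j=1}^k\lambda_j\ \ge\ \frac{d}{d+2}\,\frac{4\pi^2}{\omega_d^{2/d}}\left(\frac{k}{|\mathbb S^d|}\right)^{2/d}-z_d.$$ 3. (Equivalence) For every shift $b\ge 0$, the inequality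 in 1 with $b$ in place of $z_d$ holds for all $z\ge 0$ if and only if the inequality in 2 with $b$ in place of $z_d$ holds for all $k\ge 1$. 4. (Asymptotic optimality of $z_d$) The set of eigenvalues is $\{\lambda_{(l)}=l(l+d-1): l=0,1,2,\dots\}$. For every $l\ge 0$ there is a least $b(l)\ge 0$ such that $R_1(z)\le L^{class}_{1,d}|\mathbb S^d|(z+b(l))^{\frac d2+1}$ for all $z\in[\lambda_{(l)},\lambda_{(l+1)}]$, and $b(l)\to z_d$ as $l\to\infty$. In particular, for every real $b<z_d$ there are arbitrarily large $z$ with $R_1(z)>L^{class}_{1,d}|\mathbb S^d|(z+b)^{\frac d2+1}$. -/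

import Mathlib

open Filter Topology MeasureTheory InnerProductSpace Laplacian
open scoped Manifold ContDiff

/-- Euclidean space `ℝ^(d+1)`. -/
abbrev AmbientSpace (d : ℕ) : Type := EuclideanSpace ℝ (Fin (d + 1))

/-- The round unit sphere `𝕊^d ⊆ ℝ^(d+1)`, with Mathlib's smooth structure. -/
abbrev RoundSphere (d : ℕ) : Type := Metric.sphere (0 : AmbientSpace d) 1

/-- The extension of a function on the sphere that is constant along rays from the origin:
`y ↦ f (y / |y|)` for `y ≠ 0` (and `0` at the origin, where the value plays no role). -/
noncomputable def radialExtension (d : ℕ) (f : RoundSphere d → ℝ) (y : AmbientSpace d) : ℝ :=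
  open Classical in
  if hy : y ≠ 0 then
    f ⟨‖y‖⁻¹ • y, by
      rw [mem_sphere_zero_iff_norm, norm_smul, norm_inv, norm_norm,
        inv_mul_cancel₀ (norm_ne_zero_iff.mpr hy)]⟩
  else 0

/-- The Laplace–Beltrami operator of the round sphere, on smooth functions. In polar coordinates
the Euclidean Laplacian is `∂_r² + (d / r) ∂_r + r⁻² Δ_𝕊`, so `Δ_𝕊 f` is the Euclidean Laplacian
of the extension of `f` that does not depend on `r`, restricted to `r = 1`. -/
noncomputable def sphereLaplacian (d : ℕ) (f : RoundSphere d → ℝ) (x : RoundSphere d) : ℝ :=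
  Δ (radialExtension d f) (x : AmbientSpace d)

theorem radialExtension_add (d : ℕ) (f g : RoundSphere d → ℝ) :
    radialExtension d (f + g) = radialExtension d f + radialExtension d g := by
  ext y
  by_cases hy : y = 0 <;> simp [radialExtension, hy]

theorem radialExtension_smul (d : ℕ) (c : ℝ) (f : RoundSphere d → ℝ) :
    radialExtension d (c • f) = c • radialExtension d f := by
  ext y
  by_cases hy : y = 0 <;> simp [radialExtension, hy]

theorem radialExtension_contDiffAt (d : ℕ) {f : RoundSphere d → ℝ}
    (hf : ContMDiff (𝓡 d) 𝓘(ℝ, ℝ) ∞ f) {x : AmbientSpace d} (hx : x ≠ 0) :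
    ContDiffAt ℝ ∞ (radialExtension d f) x := by
  let U : TopologicalSpace.Opens (AmbientSpace d) := ⟨{0}ᶜ, isOpen_compl_singleton⟩
  have hU : ∀ y : U, (y : AmbientSpace d) ≠ 0 := fun y => y.2
  let g : U → AmbientSpace d := fun y => ‖(y : AmbientSpace d)‖⁻¹ • (y : AmbientSpace d)
  have hg : ContMDiff 𝓘(ℝ, AmbientSpace d) 𝓘(ℝ, AmbientSpace d) ∞ g := by
    intro y
    have h : ContDiffAt ℝ ∞ (fun y : AmbientSpace d => ‖y‖⁻¹ • y) (y : AmbientSpace d) :=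
      ((contDiffAt_norm ℝ (hU y)).inv (norm_ne_zero_iff.mpr (hU y))).smul contDiffAt_id
    exact h.contMDiffAt.comp y (contMDiff_subtype_val y)
  have hg' : ∀ y : U, g y ∈ Metric.sphere (0 : AmbientSpace d) 1 := by
    intro y
    rw [mem_sphere_zero_iff_norm, norm_smul, norm_inv, norm_norm,
      inv_mul_cancel₀ (norm_ne_zero_iff.mpr (hU y))]
  have := Fact.mk (@finrank_euclideanSpace_fin ℝ _ (d + 1))
  have h := hf.comp (ContMDiff.codRestrict_sphere hg hg')
  have hcongr : (fun y : U => radialExtension d f y) = f ∘ Set.codRestrict g _ hg' := by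
    ext y
    simp only [radialExtension, dif_pos (hU y), Function.comp_apply]
    rfl
  rw [← hcongr] at h
  exact (contMDiffAt_subtype_iff.mp (h ⟨x, hx⟩)).contDiffAt

/-- The space of smooth solutions `u` of `-Δ u = μ u` on the sphere `𝕊^d`. -/
noncomputable def laplaceEigenspace (d : ℕ) (μ : ℝ) : Submodule ℝ (RoundSphere d → ℝ) where
  carrier := {f | ContMDiff (𝓡 d) 𝓘(ℝ, ℝ) ∞ f ∧ ∀ x, -sphereLaplacian d f x = μ * f x}
  zero_mem' := by
    refine ⟨contMDiff_const, fun x => ?_⟩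
    have h : radialExtension d (0 : RoundSphere d → ℝ) = fun _ => (0 : ℝ) := by
      ext y
      by_cases hy : y = 0 <;> simp [radialExtension, hy]
    simp [sphereLaplacian, h, laplacian_const]
  add_mem' := by
    rintro f g ⟨hf, hf'⟩ ⟨hg, hg'⟩
    refine ⟨hf.add hg, fun x => ?_⟩
    have hx : (x : AmbientSpace d) ≠ 0 := ne_zero_of_mem_unit_sphere x
    have h := ContDiffAt.laplacian_add
      ((radialExtension_contDiffAt d hf hx).of_le (by norm_cast))
      ((radialExtension_contDiffAt d hg hx).of_le (by norm_cast))
    have h1 := hf' x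
    have h2 := hg' x
    simp only [sphereLaplacian, radialExtension_add, Pi.add_apply] at h h1 h2 ⊢
    rw [h]
    linarith
  smul_mem' := by
    rintro c f ⟨hf, hf'⟩
    refine ⟨(contDiff_const_smul c).contMDiff.comp hf, fun x => ?_⟩
    have hx : (x : AmbientSpace d) ≠ 0 := ne_zero_of_mem_unit_sphere x
    have h := laplacian_smul c
      ((radialExtension_contDiffAt d hf hx).of_le (m := 2) (by norm_cast))
    have h1 := hf' x
    simp only [sphereLaplacian, radialExtension_smul, Pi.smul_apply, smul_eq_mul] at h h1 ⊢
    rw [h]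
    linear_combination c * h1

/-- `lam 0 ≤ lam 1 ≤ ⋯ → ∞` lists all eigenvalues of `-Δ` on `𝕊^d`, each repeated according to
its multiplicity. The usual `λ_j`, `j ≥ 1`, is `lam (j - 1)`. -/
structure IsLaplaceSpectrum (d : ℕ) (lam : ℕ → ℝ) : Prop where
  monotone : Monotone lam
  tendsto : Tendsto lam atTop atTop
  multiplicity : ∀ μ : ℝ,
    {j : ℕ | lam j = μ}.encard = Cardinal.toENat (Module.rank ℝ (laplaceEigenspace d μ))

/-- The first Riesz mean `R₁(z) = ∑_j (z - λ_j)₊`; the sum is finite when `λ_j → ∞`. -/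
noncomputable def rieszMean (lam : ℕ → ℝ) (z : ℝ) : ℝ :=
  ∑' j : ℕ, max (z - lam j) 0

/-- The average `(λ_1 + ⋯ + λ_k) / k`. -/
noncomputable def eigenvalueAverage (lam : ℕ → ℝ) (k : ℕ) : ℝ :=
  (∑ j ∈ Finset.range k, lam j) / k

/-- The semiclassical constant
`L^class_{γ,d} = (4π)^(-d/2) Γ(γ + 1) / Γ(γ + 1 + d/2)`. -/
noncomputable def semiclassicalConst (γ : ℝ) (d : ℕ) : ℝ :=
  (4 * Real.pi) ^ (-((d : ℝ) / 2)) * Real.Gamma (γ + 1) / Real.Gamma (γ + 1 + (d : ℝ) / 2)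

/-- The surface area `|𝕊^d|`. -/
noncomputable def sphereArea (d : ℕ) : ℝ :=
  (volume : Measure (AmbientSpace d)).toSphere.real Set.univ

/-- `ω_d`, the volume of the unit ball of `ℝ^d`. -/
noncomputable def unitBallVolume (d : ℕ) : ℝ :=
  (volume : Measure (EuclideanSpace ℝ (Fin d))).real (Metric.ball 0 1)

/-- The shift `z_d = (2d - 1) d / 12`. -/
noncomputable def shiftConst (d : ℕ) : ℝ := (2 * (d : ℝ) - 1) * d / 12

/-- The shifted Weyl term `L^class_{1,d} |𝕊^d| (z + b)^(d/2 + 1)`. -/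
noncomputable def shiftedWeylTerm (d : ℕ) (b z : ℝ) : ℝ :=
  semiclassicalConst 1 d * sphereArea d * (z + b) ^ ((d : ℝ) / 2 + 1)

/-- The Berezin–Li–Yau term
`d / (d + 2) * (4π² / ω_d^(2/d)) * (k / |𝕊^d|)^(2/d)`. -/
noncomputable def berezinLiYauTerm (d k : ℕ) : ℝ :=
  (d : ℝ) / (d + 2) * (4 * Real.pi ^ 2 / unitBallVolume d ^ (2 / (d : ℝ))) *
    ((k : ℝ) / sphereArea d) ^ (2 / (d : ℝ))

/-- The `l`-th energy level `λ_(l) = l (l + d - 1)`. -/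
noncomputable def energyLevel (d l : ℕ) : ℝ := (l : ℝ) * ((l : ℝ) + d - 1)

/-!
The proof has a spectral and an elementary half.

*The spectrum.* The eigenfunctions of the Laplace–Beltrami operator are the spherical harmonics.
If `p` is harmonic and homogeneous of degree `l`, the radial extension of its restriction to the
sphere is `|y|^(-l) p(y)`, and the product rule `laplacian_radial_mul` shows that the restriction is
an eigenfunction for `λ_(l) = l(l+d-1)` (`restrictSphere_mem_laplaceEigenspace`). There are no
others: eigenfunctions for different eigenvalues are orthogonal (`sphereIntegral_mul_eq_zero`), and
the harmonic polynomials span all polynomial functions on the sphere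
(`mem_of_harmonicSubmodule_le`), which are dense by the Stone–Weierstrass theorem; see
`laplaceEigenspace_eq_bot` and `laplaceEigenspace_energyLevel`. Multiplication by `|x|²` is adjoint
to the Laplacian for the Fischer pairing of polynomials, so `Δ : P_(l+2) → P_l` is onto. This gives
the dimensions of the eigenspaces, and thus the number
`M_l = (d+l choose d) + (d+l-1 choose d)` of eigenvalues up to the level `l`
(`sum_finrank_harmonicSubmodule`).

*The inequalities.* The semiclassical constants are
`L^class_{1,d} |𝕊^d| = 4 / ((d+2) d!)` and, in the bound for the averages, `d/(d+2) A(k)` with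
`A(k) = (k d!/2)^(2/d)`. The tangent of slope `k` to the Weyl term `w(y)`, `y = z + b`, touches it
at `y = A(k)`, i.e. `k (y - d/(d+2) A(k)) ≤ w(y)` with equality there
(`mul_sub_le_shiftedWeylTerm`, `shiftedWeylTerm_of_add_eq`); since `R₁(z)` is the maximum over `k`
of `k z - (λ_1 + ⋯ + λ_k)`, the two families of inequalities are Legendre transforms of each other
(`rieszMean_le_iff_le_eigenvalueAverage`).

Between `λ_(l)` and `λ_(l+1)` the Riesz mean is `M_l (z - d/(d+2) l(l+d))`, so the least shift there
is `b(l) = d/(d+2) (A(M_l) - l(l+d))`, since the point of contact lies in that interval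
(`contact_mem_Icc`). Now `A(M_l)` is the geometric mean of the `d` numbers `(l+d/2)²` and
`(l+i)(l+d-i) = l(l+d) + i(d-i)`, `0 < i < d`, whose arithmetic mean is
`l(l+d) + (2d-1)(d+2)/12`. The inequality between the two means says precisely `b(l) ≤ z_d`
(`optimalShift_le`). Moreover the difference of the two means of `X + a_i` tends to zero as
`X → ∞`, so that `b(l) → z_d` (`optimalShift_tendsto`).
-/

/-! ### The counting numbers of the energy levels -/

/-- The number of eigenvalues up to and including the energy level `l`, with multiplicity:
`M_l = (d+l choose d) + (d+l-1 choose d)`. The first binomial coefficient is written so that both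
are quotients of ascending factorials by `d!`. The truncated subtractions are exact if `d ≥ 1`. -/
def levelCount (d l : ℕ) : ℕ := (l + 1 + d - 1).choose d + (l + d - 1).choose d

theorem factorial_mul_levelCount (e l : ℕ) :
    (e + 1).factorial * levelCount (e + 1) l = (2 * l + (e + 1)) * (l + 1).ascFactorial e := by
  rw [levelCount, mul_add, ← Nat.ascFactorial_eq_factorial_mul_choose',
    ← Nat.ascFactorial_eq_factorial_mul_choose', Nat.ascFactorial_succ, Nat.ascFactorial_succ,
    ← Nat.succ_ascFactorial l e, Nat.succ_eq_add_one]
  ring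

theorem levelCount_pos (d l : ℕ) : 0 < levelCount d l :=
  Nat.add_pos_left (Nat.choose_pos (by omega)) _

/-- The ratio of consecutive counting numbers, in product form. -/
theorem levelCount_succ_mul (e l : ℕ) :
    levelCount (e + 1) (l + 1) * ((l + 1) * (2 * l + (e + 1))) =
      levelCount (e + 1) l * ((l + (e + 1)) * (2 * l + 2 + (e + 1))) := by
  refine Nat.eq_of_mul_eq_mul_left (Nat.factorial_pos (e + 1)) ?_
  have h1 := factorial_mul_levelCount e l
  have h2 := factorial_mul_levelCount e (l + 1)
  have h3 := Nat.succ_ascFactorial (l + 1) e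
  simp only [Nat.succ_eq_add_one] at h3
  rw [← mul_assoc, h2, ← mul_assoc ((e + 1).factorial), h1]
  calc _ = (2 * (l + 1) + (e + 1)) * (2 * l + (e + 1)) *
        ((l + 1) * (l + 1 + 1).ascFactorial e) := by ring
    _ = _ := by rw [h3]; ring

theorem levelCount_lt_succ {d : ℕ} (hd : 1 ≤ d) (l : ℕ) :
    levelCount d l < levelCount d (l + 1) := by
  obtain ⟨e, rfl⟩ := Nat.exists_eq_add_of_le' hd
  have h1 : (l + 1 + (e + 1) - 1).choose (e + 1) < (l + 1 + 1 + (e + 1) - 1).choose (e + 1) := by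
    have : l + 1 + 1 + (e + 1) - 1 = (l + 1 + (e + 1) - 1) + 1 := by omega
    rw [this, Nat.choose_succ_succ, Nat.succ_eq_add_one]
    have := Nat.choose_pos (n := l + 1 + (e + 1) - 1) (k := e) (by omega)
    omega
  have h2 : (l + (e + 1) - 1).choose (e + 1) ≤ (l + 1 + (e + 1) - 1).choose (e + 1) :=
    Nat.choose_le_choose _ (by omega)
  unfold levelCount
  omega

theorem levelCount_strictMono {d : ℕ} (hd : 1 ≤ d) : StrictMono (levelCount d) :=
  strictMono_nat_of_lt_succ (levelCount_lt_succ hd)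

theorem energyLevel_strictMono {d : ℕ} (hd : 1 ≤ d) : StrictMono (energyLevel d) := by
  refine strictMono_nat_of_lt_succ fun l => ?_
  have : (1 : ℝ) ≤ d := by exact_mod_cast hd
  have hl : (0 : ℝ) ≤ l := l.cast_nonneg
  simp only [energyLevel]
  push_cast
  nlinarith

theorem energyLevel_nonneg {d : ℕ} (hd : 1 ≤ d) (l : ℕ) : 0 ≤ energyLevel d l := by
  have := (energyLevel_strictMono hd).monotone (Nat.zero_le l)
  simpa [energyLevel] using this

theorem energyLevel_tendsto {d : ℕ} (hd : 1 ≤ d) : Tendsto (energyLevel d) atTop atTop := by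
  have h1 : (1 : ℝ) ≤ d := by exact_mod_cast hd
  refine tendsto_atTop_mono' _ ?_ tendsto_natCast_atTop_atTop
  filter_upwards [eventually_ge_atTop 1] with l hl
  have : (1 : ℝ) ≤ l := by exact_mod_cast hl
  simp only [energyLevel]
  nlinarith

/-- The sum of the eigenvalues up to the energy level `l` is `d/(d+2) * l(l+d)` times their number,
where `m` are the multiplicities. -/
theorem sum_mult_mul_energyLevel {d : ℕ} (hd : 1 ≤ d) (m : ℕ → ℕ)
    (hm : ∀ l, ∑ k ∈ Finset.range (l + 1), m k = levelCount d l) (l : ℕ) :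
    ∑ k ∈ Finset.range (l + 1), (m k : ℝ) * energyLevel d k =
      levelCount d l * ((d : ℝ) / (d + 2) * (l * (l + d))) := by
  obtain ⟨e, rfl⟩ := Nat.exists_eq_add_of_le' hd
  induction l with
  | zero => simp [energyLevel]
  | succ l ih =>
    rw [Finset.sum_range_succ, ih]
    have h1 := hm (l + 1)
    rw [Finset.sum_range_succ, hm l] at h1
    have h1' : (levelCount (e + 1) l : ℝ) + m (l + 1) = levelCount (e + 1) (l + 1) := by
      exact_mod_cast h1
    have h2 : (levelCount (e + 1) (l + 1) : ℝ) * ((l + 1) * (2 * l + (e + 1))) =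
      levelCount (e + 1) l * ((l + (e + 1)) * (2 * l + 2 + (e + 1))) := by
      exact_mod_cast levelCount_succ_mul e l
    have h3 : (m (l + 1) : ℝ) = levelCount (e + 1) (l + 1) - levelCount (e + 1) l := by linarith
    rw [h3]
    have hpos : ((l : ℝ) + 1) * (2 * l + (e + 1)) ≠ 0 := by positivity
    have h4 : (levelCount (e + 1) (l + 1) : ℝ) =
      levelCount (e + 1) l * ((l + (e + 1)) * (2 * l + 2 + (e + 1))) /
        (((l : ℝ) + 1) * (2 * l + (e + 1))) := by
      rw [eq_div_iff hpos, h2]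
    rw [h4]
    simp only [energyLevel]
    push_cast
    field_simp
    ring

/-! ### The semiclassical constants -/

theorem semiclassicalConst_one_eq (d : ℕ) :
    semiclassicalConst 1 d = ((2 * Real.sqrt Real.pi) ^ d)⁻¹ /
      (((d : ℝ) / 2 + 1) * Real.Gamma ((d : ℝ) / 2 + 1)) := by
  have g2 : Real.Gamma (1 + 1 + (d : ℝ) / 2) =
      ((d : ℝ) / 2 + 1) * Real.Gamma ((d : ℝ) / 2 + 1) := by
    rw [← Real.Gamma_add_one (by positivity)]
    congr 1
    ring
  have g3 : Real.Gamma (1 + 1) = 1 := by norm_num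
  have p1 : (4 * Real.pi) ^ (-((d : ℝ) / 2)) = ((2 * Real.sqrt Real.pi) ^ d)⁻¹ := by
    have h4 : (4 * Real.pi) = (2 * Real.sqrt Real.pi) ^ (2 : ℝ) := by
      rw [Real.rpow_two, mul_pow, Real.sq_sqrt Real.pi_pos.le]
      norm_num
    rw [h4, ← Real.rpow_mul (by positivity), ← Real.rpow_natCast, ← Real.rpow_neg (by positivity)]
    congr 1
    ring
  rw [semiclassicalConst, g2, g3, p1, mul_one]

theorem sphereArea_eq (d : ℕ) :
    sphereArea d = 2 * (2 * Real.sqrt Real.pi) ^ d * Real.Gamma ((d : ℝ) / 2 + 1) /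
      d.factorial := by
  have harea : sphereArea d =
      (d + 1) * (Real.sqrt Real.pi ^ (d + 1) / Real.Gamma (((d : ℝ) + 1) / 2 + 1)) := by
    have := EuclideanSpace.volume_ball (Fin (d + 1)) (0 : AmbientSpace d) 1
    rw [sphereArea, Measure.toSphere_real_apply_univ, measureReal_def, this]
    simp only [finrank_euclideanSpace, Fintype.card_fin, Nat.cast_add, Nat.cast_one,
      ENNReal.ofReal_one, one_pow, one_mul]
    rw [ENNReal.toReal_ofReal (by positivity)]
  -- Legendre's duplication formula evaluates the product of the two Gamma factors
  have hdup := Real.Gamma_mul_Gamma_add_half (((d : ℝ) + 1) / 2)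
  have e1 : ((d : ℝ) + 1) / 2 + 1 / 2 = (d : ℝ) / 2 + 1 := by ring
  have e2 : 2 * (((d : ℝ) + 1) / 2) = d + 1 := by ring
  have e3 : 1 - 2 * (((d : ℝ) + 1) / 2) = -(d : ℝ) := by ring
  rw [e3, e1, e2, Real.Gamma_nat_eq_factorial, Real.rpow_neg zero_le_two, Real.rpow_natCast] at hdup
  have g1 : Real.Gamma (((d : ℝ) + 1) / 2 + 1) =
      ((d : ℝ) + 1) / 2 * Real.Gamma (((d : ℝ) + 1) / 2) :=
    Real.Gamma_add_one (by positivity)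
  have hG1 : 0 < Real.Gamma (((d : ℝ) + 1) / 2) := Real.Gamma_pos_of_pos (by positivity)
  have hf : (d.factorial : ℝ) ≠ 0 := by positivity
  rw [harea, g1, mul_pow, pow_succ]
  generalize Real.Gamma ((d : ℝ) / 2 + 1) = G at *
  generalize Real.Gamma (((d : ℝ) + 1) / 2) = H at *
  field_simp at hdup ⊢
  linear_combination (-1 : ℝ) * hdup

theorem semiclassicalConst_mul_sphereArea (d : ℕ) :
    semiclassicalConst 1 d * sphereArea d = 4 / ((d + 2) * d.factorial) := by
  have hG : 0 < Real.Gamma ((d : ℝ) / 2 + 1) := Real.Gamma_pos_of_pos (by positivity)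
  rw [semiclassicalConst_one_eq, sphereArea_eq]
  generalize Real.Gamma ((d : ℝ) / 2 + 1) = G at *
  field_simp
  ring

/-- The value `A(k) = (k d! / 2)^(2/d)` at which the derivative of the Weyl term equals `k`. -/
noncomputable def weylRadius (d k : ℕ) : ℝ := (k * d.factorial / 2 : ℝ) ^ (2 / (d : ℝ))

theorem weylRadius_nonneg (d k : ℕ) : 0 ≤ weylRadius d k := by unfold weylRadius; positivity

theorem weylRadius_pos (d : ℕ) {k : ℕ} (hk : 1 ≤ k) : 0 < weylRadius d k := by
  have : (0 : ℝ) < k := by exact_mod_cast hk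
  unfold weylRadius; positivity

theorem weylRadius_rpow {d : ℕ} (hd : 1 ≤ d) (k : ℕ) :
    weylRadius d k ^ ((d : ℝ) / 2) = k * d.factorial / 2 := by
  have : (0 : ℝ) < d := by exact_mod_cast hd
  rw [weylRadius, ← Real.rpow_mul (by positivity), div_mul_div_comm, mul_comm (2 : ℝ),
    div_self (by positivity), Real.rpow_one]

theorem berezinLiYauTerm_eq {d : ℕ} (hd : 1 ≤ d) (k : ℕ) :
    berezinLiYauTerm d k = d / (d + 2) * weylRadius d k := by
  have hd' : (0 : ℝ) < d := by exact_mod_cast hd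
  have : Nonempty (Fin d) := ⟨⟨0, hd⟩⟩
  have hω : unitBallVolume d = Real.sqrt Real.pi ^ d / Real.Gamma ((d : ℝ) / 2 + 1) := by
    have := EuclideanSpace.volume_ball (Fin d) (0 : EuclideanSpace ℝ (Fin d)) 1
    rw [unitBallVolume, measureReal_def, this]
    simp only [Fintype.card_fin, ENNReal.ofReal_one, one_pow, one_mul]
    rw [ENNReal.toReal_ofReal (by positivity)]
  have hG : 0 < Real.Gamma ((d : ℝ) / 2 + 1) := Real.Gamma_pos_of_pos (by positivity)
  have hωpos : 0 < unitBallVolume d := by rw [hω]; positivity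
  have hSpos : 0 < sphereArea d := by rw [sphereArea_eq]; positivity
  have h4 : 4 * Real.pi ^ 2 = ((2 * Real.pi) ^ d) ^ (2 / (d : ℝ)) := by
    rw [← Real.rpow_natCast (2 * Real.pi), ← Real.rpow_mul (by positivity),
      mul_div_cancel₀ _ hd'.ne', Real.rpow_two]
    ring
  have key : (2 * Real.pi) ^ d / unitBallVolume d * (k / sphereArea d) =
      k * d.factorial / 2 := by
    have : (2 * Real.pi) ^ d = (2 * Real.sqrt Real.pi) ^ d * Real.sqrt Real.pi ^ d := by
      rw [← mul_pow, mul_assoc, Real.mul_self_sqrt Real.pi_pos.le]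
    rw [this, hω, sphereArea_eq]
    generalize Real.Gamma ((d : ℝ) / 2 + 1) = G at *
    field_simp
  rw [berezinLiYauTerm, weylRadius, mul_assoc, h4, ← Real.div_rpow (by positivity) hωpos.le,
    ← Real.mul_rpow (by positivity) (by positivity), key]

/-! ### Legendre duality between the two Weyl terms -/

theorem shiftedWeylTerm_eq (d : ℕ) (b z : ℝ) :
    shiftedWeylTerm d b z = 4 / ((d + 2) * d.factorial) * (z + b) ^ ((d : ℝ) / 2 + 1) := by
  rw [shiftedWeylTerm, semiclassicalConst_mul_sphereArea]

theorem shiftedWeylTerm_lt {d : ℕ} {b z b' z' : ℝ} (h0 : 0 ≤ z + b) (h : z + b < z' + b') :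
    shiftedWeylTerm d b z < shiftedWeylTerm d b' z' := by
  rw [shiftedWeylTerm_eq, shiftedWeylTerm_eq]
  exact mul_lt_mul_of_pos_left (Real.rpow_lt_rpow h0 h (by positivity)) (by positivity)

theorem shiftedWeylTerm_nonneg {d : ℕ} {b z : ℝ} (h0 : 0 ≤ z + b) :
    0 ≤ shiftedWeylTerm d b z := by
  rw [shiftedWeylTerm_eq]
  positivity

/-- The line of slope `k` touching the Weyl term meets it at `z + b = A(k)`. -/
theorem shiftedWeylTerm_of_add_eq {d : ℕ} (hd : 1 ≤ d) {k : ℕ} (hk : 1 ≤ k) {b z : ℝ}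
    (h : z + b = weylRadius d k) :
    shiftedWeylTerm d b z = k * (weylRadius d k - d / (d + 2) * weylRadius d k) := by
  rw [shiftedWeylTerm_eq, h, Real.rpow_add (weylRadius_pos d hk), weylRadius_rpow hd,
    Real.rpow_one]
  field_simp
  ring

/-- The tangent of slope `k` lies below the convex Weyl term. -/
theorem mul_sub_le_shiftedWeylTerm {d : ℕ} (hd : 1 ≤ d) {k : ℕ} (hk : 1 ≤ k) {b z : ℝ}
    (h0 : 0 ≤ z + b) :
    k * (z + b - d / (d + 2) * weylRadius d k) ≤ shiftedWeylTerm d b z := by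
  have hA := weylRadius_pos d hk
  set A := weylRadius d k with hAdef
  have hC := shiftedWeylTerm_of_add_eq hd hk (b := 0) (z := A) (by simp [hAdef])
  rw [shiftedWeylTerm_eq, add_zero, ← hAdef] at hC
  rw [shiftedWeylTerm_eq]
  have hbern := one_add_mul_self_le_rpow_one_add (s := (z + b) / A - 1)
    (by linarith [div_nonneg h0 hA.le]) (p := (d : ℝ) / 2 + 1)
    (by linarith [(Nat.cast_nonneg d : (0 : ℝ) ≤ d)])
  rw [add_sub_cancel, Real.div_rpow h0 hA.le] at hbern
  have hAp : 0 < A ^ ((d : ℝ) / 2 + 1) := by positivity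
  have hk' : (0 : ℝ) ≤ k := k.cast_nonneg
  have := mul_le_mul_of_nonneg_left hbern
    (mul_nonneg hk' (by
      have : A - d / (d + 2) * A = 2 / (d + 2) * A := by field_simp; ring
      rw [this]; positivity : 0 ≤ A - d / (d + 2) * A))
  calc k * (z + b - d / (d + 2) * A)
      = k * (A - d / (d + 2) * A) * (1 + ((d : ℝ) / 2 + 1) * ((z + b) / A - 1)) := by
        field_simp
        ring
    _ ≤ _ := this
    _ = _ := by rw [← hC]; field_simp

/-! ### The best shift on an energy level -/

/-- The best shift between the energy levels `l` and `l + 1`. -/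
noncomputable def optimalShift (d l : ℕ) : ℝ :=
  d / (d + 2) * (weylRadius d (levelCount d l) - l * (l + d))

/-- The numbers `a_i` such that `l(l+d) + a_i`, `i < d`, are `(l+d/2)²` and `(l+i)(l+d-i)`,
`0 < i < d`. -/
noncomputable def levelOffset (d i : ℕ) : ℝ := if i = 0 then (d : ℝ) ^ 2 / 4 else i * (d - i)

theorem levelOffset_nonneg {d i : ℕ} (h : i < d) : 0 ≤ levelOffset d i := by
  have : (i : ℝ) < d := by exact_mod_cast h
  unfold levelOffset
  split_ifs
  · positivity
  · exact mul_nonneg i.cast_nonneg (by linarith)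

theorem sum_levelOffset {d : ℕ} (hd : 1 ≤ d) :
    ∑ i ∈ Finset.range d, levelOffset d i = (d : ℝ) * ((2 * d - 1) * (d + 2) / 12) := by
  obtain ⟨e, rfl⟩ := Nat.exists_eq_add_of_le' hd
  rw [Finset.sum_range_succ']
  simp only [levelOffset, if_true, Nat.succ_ne_zero, if_false]
  have : ∀ c : ℝ, ∀ n : ℕ, ∑ i ∈ Finset.range n, ((i + 1 : ℕ) : ℝ) * (c - ((i + 1 : ℕ) : ℝ)) =
      c * (n * (n + 1) / 2) - n * (n + 1) * (2 * n + 1) / 6 := by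
    intro c n
    induction n with
    | zero => simp
    | succ n ih => rw [Finset.sum_range_succ, ih]; push_cast; ring
  rw [this]
  push_cast
  ring

/-- Pairing the factor `l + i` with `l + d - i` turns the square of `M_l d! / 2` into a product of
`d` numbers close to `l(l+d)`. -/
theorem prod_add_levelOffset {d : ℕ} (hd : 1 ≤ d) (l : ℕ) :
    ∏ i ∈ Finset.range d, ((l : ℝ) * (l + d) + levelOffset d i) =
      (levelCount d l * d.factorial / 2 : ℝ) ^ 2 := by
  obtain ⟨e, rfl⟩ := Nat.exists_eq_add_of_le' hd
  have h1 : ((e + 1).factorial : ℝ) * levelCount (e + 1) l =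
      (2 * l + (e + 1)) * ((l + 1).ascFactorial e : ℕ) := by
    exact_mod_cast factorial_mul_levelCount e l
  have h2 : (((l + 1).ascFactorial e : ℕ) : ℝ) = ∏ i ∈ Finset.range e, ((l : ℝ) + 1 + i) := by
    rw [Nat.ascFactorial_eq_prod_range]; push_cast; rfl
  have h3 : (((l + 1).ascFactorial e : ℕ) : ℝ) = ∏ i ∈ Finset.range e, ((l : ℝ) + e - i) := by
    rw [h2, ← Finset.prod_range_reflect]
    refine Finset.prod_congr rfl fun i hi => ?_
    have : i + 1 ≤ e := Finset.mem_range.mp hi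
    rw [Nat.sub_sub, Nat.cast_sub (by omega)]
    push_cast
    ring
  have h4 : ∏ i ∈ Finset.range e, ((l : ℝ) * (l + (e + 1 : ℕ)) + levelOffset (e + 1) (i + 1)) =
      ((l + 1).ascFactorial e : ℕ) * ((l + 1).ascFactorial e : ℕ) := by
    nth_rw 1 [h2]
    rw [h3, ← Finset.prod_mul_distrib]
    refine Finset.prod_congr rfl fun i _ => ?_
    simp only [levelOffset, Nat.add_eq_zero_iff, one_ne_zero, and_false, if_false]
    push_cast
    ring
  rw [Finset.prod_range_succ', h4, mul_comm (levelCount _ _ : ℝ), h1]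
  simp only [levelOffset, if_true]
  push_cast
  ring

theorem weylRadius_levelCount {d : ℕ} (hd : 1 ≤ d) (l : ℕ) :
    weylRadius d (levelCount d l) =
      (∏ i ∈ Finset.range d, ((l : ℝ) * (l + d) + levelOffset d i)) ^ (1 / (d : ℝ)) := by
  rw [prod_add_levelOffset hd, ← Real.rpow_natCast, ← Real.rpow_mul (by positivity), weylRadius]
  congr 1
  push_cast
  ring

theorem le_weylRadius_levelCount {d : ℕ} (hd : 1 ≤ d) (l : ℕ) :
    (l : ℝ) * (l + d) ≤ weylRadius d (levelCount d l) := by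
  have hd' : (d : ℝ) ≠ 0 := by positivity
  have hX : (0 : ℝ) ≤ (l : ℝ) * (l + d) := by positivity
  rw [weylRadius_levelCount hd]
  calc (l : ℝ) * (l + d) = (((l : ℝ) * (l + d)) ^ d) ^ (1 / (d : ℝ)) := by
        rw [← Real.rpow_natCast, ← Real.rpow_mul hX, mul_one_div_cancel hd', Real.rpow_one]
    _ ≤ _ := by
        refine Real.rpow_le_rpow (by positivity) ?_ (by positivity)
        nth_rw 2 [← Finset.card_range d]
        rw [← Finset.prod_const]
        refine Finset.prod_le_prod (fun _ _ => hX) fun i hi => ?_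
        linarith [levelOffset_nonneg (Finset.mem_range.mp hi)]

/-- The radius is the geometric mean of `d` numbers whose arithmetic mean exceeds `l(l+d)` by
`(d+2)/d` times the shift of the theorem. -/
theorem weylRadius_levelCount_le {d : ℕ} (hd : 1 ≤ d) (l : ℕ) :
    weylRadius d (levelCount d l) ≤ (l : ℝ) * (l + d) + (2 * d - 1) * (d + 2) / 12 := by
  have hd' : (0 : ℝ) < d := by exact_mod_cast hd
  have hnn : ∀ i ∈ Finset.range d, 0 ≤ (l : ℝ) * (l + d) + levelOffset d i := fun i hi =>
    add_nonneg (by positivity) (levelOffset_nonneg (Finset.mem_range.mp hi))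
  have := Real.geom_mean_le_arith_mean_weighted (Finset.range d) (fun _ => 1 / (d : ℝ))
    (fun i => (l : ℝ) * (l + d) + levelOffset d i) (fun _ _ => by positivity)
    (by simp [hd'.ne']) hnn
  rw [Real.finsetProd_rpow _ _ hnn, ← weylRadius_levelCount hd, ← Finset.mul_sum,
    Finset.sum_add_distrib, sum_levelOffset hd] at this
  refine this.trans (le_of_eq ?_)
  simp only [Finset.sum_const, Finset.card_range, nsmul_eq_mul]
  field_simp

theorem optimalShift_nonneg {d : ℕ} (hd : 1 ≤ d) (l : ℕ) : 0 ≤ optimalShift d l :=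
  mul_nonneg (by positivity) (sub_nonneg.mpr (le_weylRadius_levelCount hd l))

theorem optimalShift_le {d : ℕ} (hd : 1 ≤ d) (l : ℕ) : optimalShift d l ≤ shiftConst d := by
  have h := weylRadius_levelCount_le hd l
  calc optimalShift d l ≤ d / (d + 2) * ((2 * d - 1) * (d + 2) / 12) :=
        mul_le_mul_of_nonneg_left (by linarith) (by positivity)
    _ = _ := by rw [shiftConst]; field_simp

/-- As the common part `X` of `d` numbers `X + a_i` grows, their geometric mean approaches their
arithmetic mean. -/
theorem tendsto_geom_mean_sub {d : ℕ} (hd : 1 ≤ d) (a : ℕ → ℝ)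
    (ha : ∀ i ∈ Finset.range d, 0 ≤ a i) :
    Tendsto (fun X : ℝ => (∏ i ∈ Finset.range d, (X + a i)) ^ (1 / (d : ℝ)) - X) atTop
      (𝓝 ((∑ i ∈ Finset.range d, a i) / d)) := by
  have hd' : (d : ℝ) ≠ 0 := by positivity
  have h1 : HasDerivAt (fun u : ℝ => ∏ i ∈ Finset.range d, (1 + a i * u))
      (∑ i ∈ Finset.range d, a i) 0 := by
    have := HasDerivAt.fun_finsetProd (u := Finset.range d) (x := (0 : ℝ))
      (f := fun i u => 1 + a i * u) (f' := a) (fun i _ => by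
        simpa using ((hasDerivAt_id (0 : ℝ)).const_mul (a i)).const_add 1)
    simpa using this
  have h2 := h1.rpow_const (p := 1 / (d : ℝ)) (Or.inl (by simp))
  have h3 := (hasDerivAt_iff_tendsto_slope_zero.mp h2).comp
    (tendsto_inv_atTop_nhdsGT_zero.mono_right (nhdsWithin_mono _ fun x hx => ne_of_gt hx))
  have h4 : (∑ i ∈ Finset.range d, a i) * (1 / (d : ℝ)) *
      (∏ i ∈ Finset.range d, (1 + a i * 0)) ^ (1 / (d : ℝ) - 1) =
        (∑ i ∈ Finset.range d, a i) / d := by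
    simp [div_eq_mul_inv]
  rw [h4] at h3
  refine h3.congr' ?_
  filter_upwards [eventually_gt_atTop 0] with X hX
  have hprod : ∏ i ∈ Finset.range d, (X + a i) =
      X ^ d * ∏ i ∈ Finset.range d, (1 + a i * X⁻¹) := by
    nth_rw 2 [← Finset.card_range d]
    rw [← Finset.prod_const, ← Finset.prod_mul_distrib]
    refine Finset.prod_congr rfl fun i _ => ?_
    field_simp
  have hX' : (X ^ d : ℝ) ^ (1 / (d : ℝ)) = X := by
    rw [← Real.rpow_natCast, ← Real.rpow_mul hX.le, mul_one_div_cancel hd', Real.rpow_one]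
  have hnn : 0 ≤ ∏ i ∈ Finset.range d, (1 + a i * X⁻¹) :=
    Finset.prod_nonneg fun i hi => by have := ha i hi; positivity
  rw [hprod, Real.mul_rpow (by positivity) hnn, hX']
  simp only [Function.comp_apply, inv_inv, zero_add, mul_zero, add_zero, Finset.prod_const_one,
    Real.one_rpow, smul_eq_mul]
  ring

theorem optimalShift_tendsto {d : ℕ} (hd : 1 ≤ d) :
    Tendsto (optimalShift d) atTop (𝓝 (shiftConst d)) := by
  have hd' : (1 : ℝ) ≤ d := by exact_mod_cast hd
  have hX : Tendsto (fun l : ℕ => (l : ℝ) * (l + d)) atTop atTop := by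
    refine tendsto_atTop_mono' _ ?_ tendsto_natCast_atTop_atTop
    filter_upwards with l
    nlinarith [(Nat.cast_nonneg l : (0 : ℝ) ≤ l)]
  have h := ((tendsto_geom_mean_sub hd (levelOffset d) fun i hi =>
    levelOffset_nonneg (Finset.mem_range.mp hi)).comp hX).const_mul ((d : ℝ) / (d + 2))
  have hlim : (d : ℝ) / (d + 2) * ((∑ i ∈ Finset.range d, levelOffset d i) / d) = shiftConst d := by
    rw [sum_levelOffset hd, shiftConst]
    field_simp
  rw [hlim] at h
  refine h.congr fun l => ?_
  simp only [Function.comp_apply, optimalShift, weylRadius_levelCount hd]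

/-- The point `A(M_l) - b(l)` of contact lies between the energy levels `l` and `l + 1`. -/
theorem contact_mem_Icc {d : ℕ} (hd : 1 ≤ d) (l : ℕ) :
    weylRadius d (levelCount d l) - optimalShift d l ∈
      Set.Icc (energyLevel d l) (energyLevel d (l + 1)) := by
  have hd' : (1 : ℝ) ≤ d := by exact_mod_cast hd
  have h1 := le_weylRadius_levelCount hd l
  have h2 := weylRadius_levelCount_le hd l
  have hl : (0 : ℝ) ≤ l := l.cast_nonneg
  set A := weylRadius d (levelCount d l)
  have hz : A - optimalShift d l = l * (l + d) + 2 / (d + 2) * (A - l * (l + d)) := by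
    rw [optimalShift]; field_simp; ring
  have h3 : 0 ≤ 2 / ((d : ℝ) + 2) * (A - l * (l + d)) :=
    mul_nonneg (by positivity) (by linarith)
  have h4 : 2 / ((d : ℝ) + 2) * (A - l * (l + d)) ≤ (2 * d - 1) / 6 := by
    calc _ ≤ 2 / ((d : ℝ) + 2) * ((2 * d - 1) * (d + 2) / 12) :=
          mul_le_mul_of_nonneg_left (by linarith) (by positivity)
      _ = _ := by field_simp; ring
  rw [hz, Set.mem_Icc]
  simp only [energyLevel]
  push_cast
  constructor <;> nlinarith

/-! ### Riesz means of a sequence tending to infinity -/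

theorem rieszMean_eq_sum {lam : ℕ → ℝ} {z : ℝ} {n : ℕ} (h : ∀ j, n ≤ j → z ≤ lam j) :
    rieszMean lam z = ∑ j ∈ Finset.range n, max (z - lam j) 0 :=
  tsum_eq_sum fun j hj => max_eq_right (by linarith [h j (by simpa using hj)])

theorem rieszMean_eq_mul_sub {lam : ℕ → ℝ} {z : ℝ} {n : ℕ} (h1 : ∀ j, j < n → lam j ≤ z)
    (h2 : ∀ j, n ≤ j → z ≤ lam j) :
    rieszMean lam z = n * z - ∑ j ∈ Finset.range n, lam j := by
  rw [rieszMean_eq_sum h2, Finset.sum_congr rfl fun j hj => max_eq_left (sub_nonneg.mpr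
    (h1 j (Finset.mem_range.mp hj))), Finset.sum_sub_distrib]
  simp

theorem mul_sub_sum_le_rieszMean {lam : ℕ → ℝ} (hlam : Tendsto lam atTop atTop) (z : ℝ) (k : ℕ) :
    k * z - ∑ j ∈ Finset.range k, lam j ≤ rieszMean lam z := by
  obtain ⟨n, hn⟩ := eventually_atTop.mp (hlam.eventually_ge_atTop z)
  rw [rieszMean_eq_sum (n := max n k) fun j hj => hn j (le_of_max_le_left hj)]
  calc k * z - ∑ j ∈ Finset.range k, lam j = ∑ j ∈ Finset.range k, (z - lam j) := by
        simp [Finset.sum_sub_distrib]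
    _ ≤ ∑ j ∈ Finset.range k, max (z - lam j) 0 :=
        Finset.sum_le_sum fun j _ => le_max_left _ _
    _ ≤ _ := Finset.sum_le_sum_of_subset_of_nonneg
        (Finset.range_subset_range.mpr (le_max_right _ _)) fun j _ _ => le_max_right _ _

theorem exists_rieszMean_eq {lam : ℕ → ℝ} (hmono : Monotone lam) (hlam : Tendsto lam atTop atTop)
    (z : ℝ) : ∃ k : ℕ, rieszMean lam z = k * z - ∑ j ∈ Finset.range k, lam j := by
  classical
  have hex : ∃ n, z ≤ lam n := (hlam.eventually_ge_atTop z).exists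
  exact ⟨Nat.find hex, rieszMean_eq_mul_sub
    (fun j hj => (not_le.mp (Nat.find_min hex hj)).le)
    (fun j hj => (Nat.find_spec hex).trans (hmono hj))⟩

/-- The two families of inequalities are Legendre transforms of each other. -/
theorem rieszMean_le_iff_le_eigenvalueAverage {d : ℕ} (hd : 1 ≤ d) {lam : ℕ → ℝ}
    (hmono : Monotone lam) (hlam : Tendsto lam atTop atTop) (hnn : ∀ j, 0 ≤ lam j)
    {b : ℝ} (hb : 0 ≤ b) :
    (∀ z : ℝ, 0 ≤ z → rieszMean lam z ≤ shiftedWeylTerm d b z) ↔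
      ∀ k : ℕ, 1 ≤ k → berezinLiYauTerm d k - b ≤ eigenvalueAverage lam k := by
  constructor
  · intro h k hk
    have hk' : (0 : ℝ) < k := by exact_mod_cast hk
    rw [berezinLiYauTerm_eq hd, eigenvalueAverage, le_div_iff₀ hk']
    rcases le_or_gt b (weylRadius d k) with hA | hA
    · have h1 := h (weylRadius d k - b) (by linarith)
      rw [shiftedWeylTerm_of_add_eq hd hk (by ring)] at h1
      have h2 := mul_sub_sum_le_rieszMean hlam (weylRadius d k - b) k
      linarith
    · -- the touching point is negative, and the bound is trivial
      have h1 : (d : ℝ) / (d + 2) ≤ 1 := div_le_one_of_le₀ (by linarith) (by positivity)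
      have h2 := mul_le_mul_of_nonneg_right h1 (weylRadius_nonneg d k)
      have h3 : (d / (d + 2) * weylRadius d k - b) * k ≤ 0 :=
        mul_nonpos_of_nonpos_of_nonneg (by linarith) hk'.le
      exact h3.trans (Finset.sum_nonneg fun j _ => hnn j)
  · intro h z hz
    obtain ⟨k, hk⟩ := exists_rieszMean_eq hmono hlam z
    rw [hk]
    rcases Nat.eq_zero_or_pos k with rfl | hk1
    · simpa using shiftedWeylTerm_nonneg (add_nonneg hz hb)
    · have hk' : (0 : ℝ) < k := by exact_mod_cast hk1
      have h1 := h k hk1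
      rw [berezinLiYauTerm_eq hd, eigenvalueAverage, le_div_iff₀ hk'] at h1
      have h2 := mul_sub_le_shiftedWeylTerm hd hk1 (add_nonneg hz hb)
      linarith

/-! ### Sequences with the multiplicities of the energy levels -/

/-- A listing of the energy levels in increasing order in which each energy level `k` has
multiplicity `m k`, and there are no other entries. -/
structure ListsEnergyLevels (d : ℕ) (m : ℕ → ℕ) (lam : ℕ → ℝ) : Prop where
  monotone : Monotone lam
  mem_range : ∀ j, lam j ∈ Set.range (energyLevel d)
  encard : ∀ l, {j : ℕ | lam j = energyLevel d l}.encard = m l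

theorem ListsEnergyLevels.encard_le {d : ℕ} (hd : 1 ≤ d) {m : ℕ → ℕ} {lam : ℕ → ℝ}
    (h : ListsEnergyLevels d m lam) (hm : ∀ l, ∑ k ∈ Finset.range (l + 1), m k = levelCount d l)
    (l : ℕ) : {j : ℕ | lam j ≤ energyLevel d l}.encard = levelCount d l := by
  have hmono := energyLevel_strictMono hd
  induction l with
  | zero =>
    rw [← hm 0, Finset.sum_range_one, ← h.encard 0]
    congr 1
    ext j
    refine ⟨fun hj => le_antisymm hj ?_, fun hj => le_of_eq hj⟩
    obtain ⟨k, hk⟩ := h.mem_range j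
    rw [← hk]
    exact hmono.monotone (Nat.zero_le k)
  | succ l ih =>
    have hunion : {j : ℕ | lam j ≤ energyLevel d (l + 1)} =
        {j | lam j ≤ energyLevel d l} ∪ {j | lam j = energyLevel d (l + 1)} := by
      ext j
      obtain ⟨k, hk⟩ := h.mem_range j
      simp only [Set.mem_union, Set.mem_ofPred_eq, ← hk, hmono.le_iff_le, hmono.injective.eq_iff]
      omega
    have hdisj : Disjoint {j : ℕ | lam j ≤ energyLevel d l}
        {j | lam j = energyLevel d (l + 1)} := by
      refine Set.disjoint_left.mpr fun j hj hj' => ?_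
      simp only [Set.mem_ofPred_eq] at hj hj'
      rw [hj', hmono.le_iff_le] at hj
      omega
    rw [hunion, Set.encard_union_eq hdisj, ih, h.encard, ← hm (l + 1), Finset.sum_range_succ, hm l]
    push_cast
    rfl

/-- The entries up to the energy level `l` form an initial segment with `M_l` elements. -/
theorem ListsEnergyLevels.le_energyLevel_iff {d : ℕ} (hd : 1 ≤ d) {m : ℕ → ℕ} {lam : ℕ → ℝ}
    (h : ListsEnergyLevels d m lam) (hm : ∀ l, ∑ k ∈ Finset.range (l + 1), m k = levelCount d l)
    (j l : ℕ) : lam j ≤ energyLevel d l ↔ j < levelCount d l := by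
  have hcard := h.encard_le hd hm l
  constructor
  · intro hj
    have hsub : (Finset.range (j + 1) : Set ℕ) ⊆ {j : ℕ | lam j ≤ energyLevel d l} := by
      intro i hi
      have : i < j + 1 := by simpa using hi
      exact (h.monotone (Nat.lt_succ_iff.mp this)).trans hj
    have := Set.encard_le_encard hsub
    rw [hcard, Set.encard_coe_eq_coe_finsetCard, Finset.card_range] at this
    exact_mod_cast this
  · intro hj
    by_contra hcon
    have hsub : {j : ℕ | lam j ≤ energyLevel d l} ⊆ (Finset.range j : Set ℕ) := by
      intro i hi
      rw [Finset.coe_range, Set.mem_Iio]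
      by_contra hij
      exact hcon ((h.monotone (not_lt.mp hij)).trans hi)
    have := Set.encard_le_encard hsub
    rw [hcard, Set.encard_coe_eq_coe_finsetCard, Finset.card_range] at this
    exact absurd hj (not_lt.mpr (by exact_mod_cast this))

theorem ListsEnergyLevels.eq_energyLevel_succ {d : ℕ} (hd : 1 ≤ d) {m : ℕ → ℕ} {lam : ℕ → ℝ}
    (h : ListsEnergyLevels d m lam) (hm : ∀ l, ∑ k ∈ Finset.range (l + 1), m k = levelCount d l)
    {j l : ℕ} (h1 : levelCount d l ≤ j) (h2 : j < levelCount d (l + 1)) :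
    lam j = energyLevel d (l + 1) := by
  have hmono := energyLevel_strictMono hd
  have h1' := mt (h.le_energyLevel_iff hd hm j l).mp (not_lt.mpr h1)
  have h2' := (h.le_energyLevel_iff hd hm j (l + 1)).mpr h2
  obtain ⟨k, hk⟩ := h.mem_range j
  rw [← hk, hmono.le_iff_le] at h1' h2'
  rw [← hk]
  congr 1
  omega

theorem ListsEnergyLevels.sum_range_levelCount {d : ℕ} (hd : 1 ≤ d) {m : ℕ → ℕ} {lam : ℕ → ℝ}
    (h : ListsEnergyLevels d m lam) (hm : ∀ l, ∑ k ∈ Finset.range (l + 1), m k = levelCount d l)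
    (l : ℕ) : ∑ j ∈ Finset.range (levelCount d l), lam j =
      levelCount d l * ((d : ℝ) / (d + 2) * (l * (l + d))) := by
  rw [← sum_mult_mul_energyLevel hd m hm l]
  induction l with
  | zero =>
    have h0 : ∀ j ∈ Finset.range (levelCount d 0), lam j = 0 := by
      intro j hj
      have hj' := (h.le_energyLevel_iff hd hm j 0).mpr (Finset.mem_range.mp hj)
      obtain ⟨k, hk⟩ := h.mem_range j
      have := energyLevel_nonneg hd k
      simp only [energyLevel, Nat.cast_zero, zero_mul] at hj'
      linarith
    rw [Finset.sum_eq_zero h0]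
    simp [energyLevel]
  | succ l ih =>
    have hlt := levelCount_lt_succ hd l
    have hcard : levelCount d (l + 1) - levelCount d l = m (l + 1) := by
      rw [← hm (l + 1), Finset.sum_range_succ, hm l, Nat.add_sub_cancel_left]
    rw [Finset.sum_range_succ, ← ih, ← Finset.sum_range_add_sum_Ico _ hlt.le]
    congr 1
    rw [Finset.sum_congr rfl fun j hj => h.eq_energyLevel_succ hd hm (Finset.mem_Ico.mp hj).1
      (Finset.mem_Ico.mp hj).2, Finset.sum_const, Nat.card_Ico, hcard, nsmul_eq_mul]

theorem ListsEnergyLevels.tendsto {d : ℕ} (hd : 1 ≤ d) {m : ℕ → ℕ} {lam : ℕ → ℝ}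
    (h : ListsEnergyLevels d m lam) (hm : ∀ l, ∑ k ∈ Finset.range (l + 1), m k = levelCount d l) :
    Tendsto lam atTop atTop := by
  refine tendsto_atTop_atTop_of_monotone h.monotone fun b => ?_
  obtain ⟨l, hl⟩ := ((energyLevel_tendsto hd).eventually_ge_atTop b).exists
  exact ⟨levelCount d l, hl.trans
    (not_le.mp (mt (h.le_energyLevel_iff hd hm _ l).mp (lt_irrefl _))).le⟩

/-- The Riesz mean is linear between consecutive energy levels. -/
theorem ListsEnergyLevels.rieszMean_eq {d : ℕ} (hd : 1 ≤ d) {m : ℕ → ℕ} {lam : ℕ → ℝ}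
    (h : ListsEnergyLevels d m lam) (hm : ∀ l, ∑ k ∈ Finset.range (l + 1), m k = levelCount d l)
    {l : ℕ} {z : ℝ} (hz : z ∈ Set.Icc (energyLevel d l) (energyLevel d (l + 1))) :
    rieszMean lam z = levelCount d l * (z - d / (d + 2) * (l * (l + d))) := by
  have hmono := energyLevel_strictMono hd
  rw [rieszMean_eq_mul_sub (n := levelCount d l), h.sum_range_levelCount hd hm, mul_sub]
  · exact fun j hj => ((h.le_energyLevel_iff hd hm j l).mpr hj).trans hz.1
  · intro j hj
    have hj' := mt (h.le_energyLevel_iff hd hm j l).mp (not_lt.mpr hj)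
    obtain ⟨k, hk⟩ := h.mem_range j
    rw [← hk, hmono.le_iff_le] at hj'
    rw [← hk]
    exact hz.2.trans (hmono.monotone (by omega))

theorem ListsEnergyLevels.range_eq {d : ℕ} (hd : 1 ≤ d) {m : ℕ → ℕ} {lam : ℕ → ℝ}
    (h : ListsEnergyLevels d m lam) (hm : ∀ l, ∑ k ∈ Finset.range (l + 1), m k = levelCount d l) :
    Set.range lam = Set.range (energyLevel d) := by
  refine Set.Subset.antisymm (Set.range_subset_iff.mpr h.mem_range)
    (Set.range_subset_iff.mpr fun l => ?_)
  have hpos : 0 < m l := by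
    cases l with
    | zero =>
      have := hm 0
      rw [Finset.sum_range_one] at this
      exact this ▸ levelCount_pos d 0
    | succ l =>
      have := hm (l + 1)
      rw [Finset.sum_range_succ, hm l] at this
      have := levelCount_lt_succ hd l
      omega
  have hne : {j : ℕ | lam j = energyLevel d l}.encard ≠ 0 := by
    rw [h.encard]
    exact_mod_cast hpos.ne'
  exact Set.encard_ne_zero.mp hne

theorem exists_listsEnergyLevels {d : ℕ} (hd : 1 ≤ d) {m : ℕ → ℕ}
    (hm : ∀ l, ∑ k ∈ Finset.range (l + 1), m k = levelCount d l) :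
    ∃ lam : ℕ → ℝ, ListsEnergyLevels d m lam := by
  classical
  have hM := levelCount_strictMono hd
  have hmono := energyLevel_strictMono hd
  have hex : ∀ j, ∃ l, j < levelCount d l := fun j => ⟨j + 1, hM.le_apply.trans_lt' (by omega)⟩
  refine ⟨fun j => energyLevel d (Nat.find (hex j)), ?_, fun j => ⟨_, rfl⟩, fun l => ?_⟩
  · intro i j hij
    exact hmono.monotone (Nat.find_mono fun l hl => hij.trans_lt hl)
  · simp only [hmono.injective.eq_iff]
    cases l with
    | zero =>
      have : {j : ℕ | Nat.find (hex j) = 0} = (Finset.range (levelCount d 0) : Set ℕ) := by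
        ext j
        simp [Nat.find_eq_zero]
      rw [this, Set.encard_coe_eq_coe_finsetCard, Finset.card_range, ← hm 0, Finset.sum_range_one]
    | succ l =>
      have : {j : ℕ | Nat.find (hex j) = l + 1} =
          (Finset.Ico (levelCount d l) (levelCount d (l + 1)) : Set ℕ) := by
        ext j
        simp only [Set.mem_ofPred_eq, Nat.find_eq_iff, Finset.coe_Ico, Set.mem_Ico, not_lt]
        exact ⟨fun ⟨h1, h2⟩ => ⟨h2 l (Nat.lt_succ_self l), h1⟩, fun ⟨h1, h2⟩ =>
          ⟨h2, fun n hn => (hM.monotone (Nat.lt_succ_iff.mp hn)).trans h1⟩⟩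
      rw [this, Set.encard_coe_eq_coe_finsetCard, Nat.card_Ico, ← hm (l + 1),
        Finset.sum_range_succ, hm l, Nat.add_sub_cancel_left]

/-! ### Riesz means of the energy levels -/

/-- Between two energy levels the Riesz mean lies below the Weyl term shifted by the best shift. -/
theorem ListsEnergyLevels.rieszMean_le {d : ℕ} (hd : 1 ≤ d) {m : ℕ → ℕ} {lam : ℕ → ℝ}
    (h : ListsEnergyLevels d m lam) (hm : ∀ l, ∑ k ∈ Finset.range (l + 1), m k = levelCount d l)
    {l : ℕ} {z b : ℝ} (hz : z ∈ Set.Icc (energyLevel d l) (energyLevel d (l + 1)))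
    (hb : optimalShift d l ≤ b) : rieszMean lam z ≤ shiftedWeylTerm d b z := by
  have hz0 := (energyLevel_nonneg hd l).trans hz.1
  have hb0 := (optimalShift_nonneg hd l).trans hb
  rw [h.rieszMean_eq hd hm hz]
  refine le_trans ?_ (mul_sub_le_shiftedWeylTerm hd (levelCount_pos d l) (add_nonneg hz0 hb0))
  refine mul_le_mul_of_nonneg_left ?_ (Nat.cast_nonneg _)
  rw [optimalShift, mul_sub] at hb
  linarith

/-- No smaller shift is admissible at the point of contact. -/
theorem ListsEnergyLevels.lt_rieszMean_contact {d : ℕ} (hd : 1 ≤ d) {m : ℕ → ℕ} {lam : ℕ → ℝ}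
    (h : ListsEnergyLevels d m lam) (hm : ∀ l, ∑ k ∈ Finset.range (l + 1), m k = levelCount d l)
    {l : ℕ} {b : ℝ} (hb : b < optimalShift d l)
    (h0 : 0 ≤ weylRadius d (levelCount d l) - optimalShift d l + b) :
    shiftedWeylTerm d b (weylRadius d (levelCount d l) - optimalShift d l) <
      rieszMean lam (weylRadius d (levelCount d l) - optimalShift d l) := by
  refine (shiftedWeylTerm_lt (b' := optimalShift d l)
    (z' := weylRadius d (levelCount d l) - optimalShift d l) h0 (by linarith)).trans_le ?_
  rw [h.rieszMean_eq hd hm (contact_mem_Icc hd l),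
    shiftedWeylTerm_of_add_eq hd (levelCount_pos d l) (sub_add_cancel _ _)]
  refine le_of_eq ?_
  congr 1
  rw [optimalShift]
  ring

theorem exists_mem_Icc_energyLevel {d : ℕ} (hd : 1 ≤ d) {z : ℝ} (hz : 0 ≤ z) :
    ∃ l, z ∈ Set.Icc (energyLevel d l) (energyLevel d (l + 1)) := by
  classical
  have hex : ∃ l, z < energyLevel d l := ((energyLevel_tendsto hd).eventually_gt_atTop z).exists
  have hne : Nat.find hex ≠ 0 := by
    intro h0
    have := Nat.find_spec hex
    rw [h0] at this
    simp only [energyLevel, Nat.cast_zero, zero_mul] at this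
    linarith
  obtain ⟨l, hl⟩ := Nat.exists_eq_succ_of_ne_zero hne
  refine ⟨l, not_lt.mp (Nat.find_min hex (by omega)), ?_⟩
  have := (Nat.find_spec hex).le
  rwa [hl] at this

theorem ListsEnergyLevels.rieszMean_le_shiftConst {d : ℕ} (hd : 1 ≤ d) {m : ℕ → ℕ} {lam : ℕ → ℝ}
    (h : ListsEnergyLevels d m lam) (hm : ∀ l, ∑ k ∈ Finset.range (l + 1), m k = levelCount d l)
    {z : ℝ} (hz : 0 ≤ z) : rieszMean lam z ≤ shiftedWeylTerm d (shiftConst d) z := by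
  obtain ⟨l, hl⟩ := exists_mem_Icc_energyLevel hd hz
  exact h.rieszMean_le hd hm hl (optimalShift_le hd l)

theorem ListsEnergyLevels.isLeast_optimalShift {d : ℕ} (hd : 1 ≤ d) {m : ℕ → ℕ} {lam : ℕ → ℝ}
    (h : ListsEnergyLevels d m lam) (hm : ∀ l, ∑ k ∈ Finset.range (l + 1), m k = levelCount d l)
    (l : ℕ) : IsLeast {b : ℝ | 0 ≤ b ∧ ∀ z ∈ Set.Icc (energyLevel d l) (energyLevel d (l + 1)),
      rieszMean lam z ≤ shiftedWeylTerm d b z} (optimalShift d l) := by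
  refine ⟨⟨optimalShift_nonneg hd l, fun z hz => h.rieszMean_le hd hm hz le_rfl⟩, ?_⟩
  rintro b ⟨hb0, hb⟩
  by_contra hlt
  have hmem := contact_mem_Icc hd l
  have h0 := (energyLevel_nonneg hd l).trans hmem.1
  exact absurd (hb _ hmem) (not_le.mpr
    (h.lt_rieszMean_contact hd hm (not_le.mp hlt) (add_nonneg h0 hb0)))

theorem ListsEnergyLevels.frequently_lt_rieszMean {d : ℕ} (hd : 1 ≤ d) {m : ℕ → ℕ} {lam : ℕ → ℝ}
    (h : ListsEnergyLevels d m lam) (hm : ∀ l, ∑ k ∈ Finset.range (l + 1), m k = levelCount d l)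
    {b : ℝ} (hb : b < shiftConst d) :
    ∃ᶠ z : ℝ in atTop, shiftedWeylTerm d b z < rieszMean lam z := by
  have hz : Tendsto (fun l => weylRadius d (levelCount d l) - optimalShift d l) atTop atTop :=
    tendsto_atTop_mono (fun l => (contact_mem_Icc hd l).1) (energyLevel_tendsto hd)
  refine hz.frequently (Eventually.frequently ?_)
  filter_upwards [(optimalShift_tendsto hd).eventually_const_lt hb, hz.eventually_ge_atTop (-b)]
    with l h1 h2
  exact h.lt_rieszMean_contact hd hm h1 (by linarith)

/-! ### Homogeneous harmonic polynomials -/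

/-- The Laplacian of polynomials. -/
noncomputable def polyLaplacian (σ : Type*) [Fintype σ] :
    MvPolynomial σ ℝ →ₗ[ℝ] MvPolynomial σ ℝ :=
  ∑ i, (MvPolynomial.pderiv i).toLinearMap ∘ₗ (MvPolynomial.pderiv i).toLinearMap

theorem polyLaplacian_apply {σ : Type*} [Fintype σ] (p : MvPolynomial σ ℝ) :
    polyLaplacian σ p = ∑ i, MvPolynomial.pderiv i (MvPolynomial.pderiv i p) := by
  simp [polyLaplacian]

/-- The polynomial `∑ i, X_i²`. -/
noncomputable def normSqPoly (σ : Type*) [Fintype σ] : MvPolynomial σ ℝ :=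
  ∑ i, MvPolynomial.X i * MvPolynomial.X i

theorem normSqPoly_isHomogeneous (σ : Type*) [Fintype σ] : (normSqPoly σ).IsHomogeneous 2 :=
  MvPolynomial.IsHomogeneous.sum _ _ _ fun i _ =>
    (MvPolynomial.isHomogeneous_X ℝ i).mul (MvPolynomial.isHomogeneous_X ℝ i)

theorem normSqPoly_ne_zero (σ : Type*) [Fintype σ] [Nonempty σ] : normSqPoly σ ≠ 0 := by
  intro h
  have := congrArg (MvPolynomial.eval fun _ => (1 : ℝ)) h
  simp [normSqPoly] at this

theorem polyLaplacian_isHomogeneous {σ : Type*} [Fintype σ] {p : MvPolynomial σ ℝ} {l : ℕ}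
    (hp : p.IsHomogeneous (l + 2)) : (polyLaplacian σ p).IsHomogeneous l := by
  rw [polyLaplacian_apply]
  exact MvPolynomial.IsHomogeneous.sum _ _ _ fun i _ => hp.pderiv.pderiv

theorem polyLaplacian_eq_zero_of_lt_two {σ : Type*} [Fintype σ] {p : MvPolynomial σ ℝ} {l : ℕ}
    (hl : l < 2) (hp : p.IsHomogeneous l) : polyLaplacian σ p = 0 := by
  rw [polyLaplacian_apply]
  refine Finset.sum_eq_zero fun i _ => ?_
  have h0 : (MvPolynomial.pderiv i p).IsHomogeneous 0 := by
    have := hp.pderiv (i := i)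
    rwa [show l - 1 = 0 by omega] at this
  rw [← MvPolynomial.totalDegree_zero_iff_isHomogeneous,
    MvPolynomial.totalDegree_eq_zero_iff_eq_C] at h0
  rw [h0, MvPolynomial.pderiv_C]

/-- The Fischer pairing `p ↦ ∑_α α! p_α q_α` with a polynomial `q`. -/
noncomputable def fischerPairing {σ : Type*} [Fintype σ] (q : MvPolynomial σ ℝ) :
    MvPolynomial σ ℝ →ₗ[ℝ] ℝ :=
  (MvPolynomial.basisMonomials σ ℝ).constr ℝ
    fun α => (∏ i, (α i).factorial : ℕ) * MvPolynomial.coeff α q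

theorem fischerPairing_monomial {σ : Type*} [Fintype σ] (q : MvPolynomial σ ℝ) (α : σ →₀ ℕ)
    (a : ℝ) : fischerPairing q (MvPolynomial.monomial α a) =
      a * ((∏ i, (α i).factorial : ℕ) * MvPolynomial.coeff α q) := by
  have h : MvPolynomial.monomial α a = a • MvPolynomial.basisMonomials σ ℝ α := by
    rw [MvPolynomial.coe_basisMonomials, MvPolynomial.smul_monomial, smul_eq_mul, mul_one]
  rw [h, map_smul, fischerPairing, Module.Basis.constr_basis, smul_eq_mul]

/-- Multiplication by a variable and the corresponding partial derivative are adjoint. -/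
theorem fischerPairing_X_mul {σ : Type*} [Fintype σ] (i : σ) (p q : MvPolynomial σ ℝ) :
    fischerPairing q (MvPolynomial.X i * p) = fischerPairing (MvPolynomial.pderiv i q) p := by
  classical
  induction p using MvPolynomial.induction_on' with
  | add p₁ p₂ h₁ h₂ => rw [mul_add, map_add, map_add, h₁, h₂]
  | monomial α a =>
    rw [MvPolynomial.X, MvPolynomial.monomial_mul, one_mul, fischerPairing_monomial,
      fischerPairing_monomial, MvPolynomial.coeff_pderiv, add_comm (Finsupp.single i 1) α]
    have h : ∏ j, ((α + Finsupp.single i 1 : σ →₀ ℕ) j).factorial =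
        (α i + 1) * ∏ j, (α j).factorial := by
      rw [← Finset.mul_prod_erase _ _ (Finset.mem_univ i),
        ← Finset.mul_prod_erase Finset.univ (fun j => (α j).factorial) (Finset.mem_univ i),
        ← mul_assoc]
      congr 1
      · simp [Nat.factorial_succ]
      · refine Finset.prod_congr rfl fun j hj => ?_
        simp [Finsupp.single_eq_of_ne (Finset.ne_of_mem_erase hj)]
    rw [h]
    push_cast
    ring

theorem fischerPairing_normSqPoly_mul {σ : Type*} [Fintype σ] (p q : MvPolynomial σ ℝ) :
    fischerPairing q (normSqPoly σ * p) = fischerPairing (polyLaplacian σ q) p := by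
  have hsum : ∀ f : σ → MvPolynomial σ ℝ,
      fischerPairing (∑ i, f i) p = ∑ i, fischerPairing (f i) p := by
    intro f
    induction p using MvPolynomial.induction_on' with
    | add p₁ p₂ h₁ h₂ => simp only [map_add, h₁, h₂, Finset.sum_add_distrib]
    | monomial α a =>
      simp only [fischerPairing_monomial, MvPolynomial.coeff_sum, Finset.mul_sum]
  rw [polyLaplacian_apply, hsum, normSqPoly, Finset.sum_mul, map_sum]
  simp only [mul_assoc, fischerPairing_X_mul]

theorem eq_zero_of_fischerPairing_self {σ : Type*} [Fintype σ] {p : MvPolynomial σ ℝ}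
    (h : fischerPairing p p = 0) : p = 0 := by
  have hsum : fischerPairing p p = ∑ α ∈ p.support,
      MvPolynomial.coeff α p * ((∏ i, (α i).factorial : ℕ) * MvPolynomial.coeff α p) := by
    conv_lhs => rw [p.as_sum]
    rw [map_sum]
    refine Finset.sum_congr rfl fun α _ => ?_
    rw [← p.as_sum, fischerPairing_monomial]
  have hw : ∀ α : σ →₀ ℕ, (0 : ℝ) < (∏ i, (α i).factorial : ℕ) := fun α => by
    exact_mod_cast Finset.prod_pos fun i _ => Nat.factorial_pos _
  rw [hsum, Finset.sum_eq_zero_iff_of_nonneg] at h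
  · ext α
    by_cases hα : α ∈ p.support
    · have := h α hα
      exact (mul_eq_zero.mp this).elim id fun h' => (mul_eq_zero.mp h').resolve_left (hw α).ne'
    · simpa using hα
  · intro α _
    have := hw α
    nlinarith [mul_nonneg this.le (mul_self_nonneg (MvPolynomial.coeff α p))]

theorem fischerPairing_zero {σ : Type*} [Fintype σ] :
    fischerPairing (0 : MvPolynomial σ ℝ) = 0 :=
  (MvPolynomial.basisMonomials σ ℝ).ext fun α => by
    rw [fischerPairing, Module.Basis.constr_basis]
    simp

theorem polyLaplacian_normSqPoly_mul_injective {σ : Type*} [Fintype σ] [Nonempty σ]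
    {p : MvPolynomial σ ℝ} (h : polyLaplacian σ (normSqPoly σ * p) = 0) : p = 0 := by
  have h1 := fischerPairing_normSqPoly_mul p (normSqPoly σ * p)
  rw [h] at h1
  rw [fischerPairing_zero, LinearMap.zero_apply] at h1
  exact (mul_eq_zero.mp (eq_zero_of_fischerPairing_self h1)).resolve_left (normSqPoly_ne_zero σ)

instance homogeneousSubmodule_finite (σ : Type*) [Finite σ] (l : ℕ) :
    Module.Finite ℝ (MvPolynomial.homogeneousSubmodule σ ℝ l) :=
  Module.Finite.iff_fg.mpr (MvPolynomial.homogeneousSubmodule_fg σ ℝ l)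

/-- The Laplacian from the homogeneous polynomials of degree `l + 2` to those of degree `l`. -/
noncomputable def homogeneousLaplacian (σ : Type*) [Fintype σ] (l : ℕ) :
    MvPolynomial.homogeneousSubmodule σ ℝ (l + 2) →ₗ[ℝ] MvPolynomial.homogeneousSubmodule σ ℝ l :=
  (polyLaplacian σ).restrict fun _ hp => polyLaplacian_isHomogeneous hp

/-- For every homogeneous `p` there is a homogeneous `q` with `Δ (|x|² q) = p`: on the
finite-dimensional space of homogeneous polynomials the map `q ↦ Δ (|x|² q)` is injective, since
multiplication by `|x|²` is adjoint to `Δ` for the Fischer pairing. -/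
theorem exists_polyLaplacian_normSqPoly_mul {σ : Type*} [Fintype σ] [Nonempty σ] {l : ℕ}
    {p : MvPolynomial σ ℝ} (hp : p.IsHomogeneous l) :
    ∃ q : MvPolynomial σ ℝ, q.IsHomogeneous l ∧ polyLaplacian σ (normSqPoly σ * q) = p := by
  let T : MvPolynomial.homogeneousSubmodule σ ℝ l →ₗ[ℝ] MvPolynomial.homogeneousSubmodule σ ℝ l :=
    (polyLaplacian σ ∘ₗ LinearMap.mulLeft ℝ (normSqPoly σ)).restrict fun q hq =>
      polyLaplacian_isHomogeneous (by
        have := (normSqPoly_isHomogeneous σ).mul hq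
        rwa [add_comm] at this)
  have hinj : Function.Injective T := by
    refine (injective_iff_map_eq_zero T).mpr fun q hq => ?_
    exact Subtype.ext (polyLaplacian_normSqPoly_mul_injective (congrArg Subtype.val hq))
  obtain ⟨q, hq⟩ := (LinearMap.injective_iff_surjective.mp hinj) ⟨p, hp⟩
  exact ⟨q, q.2, congrArg Subtype.val hq⟩

theorem homogeneousLaplacian_surjective (σ : Type*) [Fintype σ] [Nonempty σ] (l : ℕ) :
    Function.Surjective (homogeneousLaplacian σ l) := by
  rintro ⟨p, hp⟩
  obtain ⟨q, hq, hqp⟩ := exists_polyLaplacian_normSqPoly_mul hp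
  refine ⟨⟨normSqPoly σ * q, ?_⟩, Subtype.ext hqp⟩
  have := (normSqPoly_isHomogeneous σ).mul hq
  rwa [add_comm] at this

/-- The homogeneous harmonic polynomials of degree `l`. -/
noncomputable def harmonicSubmodule (σ : Type*) [Fintype σ] (l : ℕ) :
    Submodule ℝ (MvPolynomial σ ℝ) :=
  MvPolynomial.homogeneousSubmodule σ ℝ l ⊓ LinearMap.ker (polyLaplacian σ)

theorem mem_harmonicSubmodule {σ : Type*} [Fintype σ] {l : ℕ} {p : MvPolynomial σ ℝ} :
    p ∈ harmonicSubmodule σ l ↔ p.IsHomogeneous l ∧ polyLaplacian σ p = 0 := Iff.rfl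

instance harmonicSubmodule_finite (σ : Type*) [Fintype σ] (l : ℕ) :
    Module.Finite ℝ (harmonicSubmodule σ l) :=
  Submodule.finiteDimensional_of_le
    (inf_le_left : harmonicSubmodule σ l ≤ MvPolynomial.homogeneousSubmodule σ ℝ l)

theorem harmonicSubmodule_of_lt_two (σ : Type*) [Fintype σ] {l : ℕ} (hl : l < 2) :
    harmonicSubmodule σ l = MvPolynomial.homogeneousSubmodule σ ℝ l :=
  inf_eq_left.mpr fun _ hp => polyLaplacian_eq_zero_of_lt_two hl hp

theorem finrank_harmonicSubmodule_add (σ : Type*) [Fintype σ] [Nonempty σ] (l : ℕ) :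
    Module.finrank ℝ (MvPolynomial.homogeneousSubmodule σ ℝ l) +
      Module.finrank ℝ (harmonicSubmodule σ (l + 2)) =
        Module.finrank ℝ (MvPolynomial.homogeneousSubmodule σ ℝ (l + 2)) := by
  have h := (homogeneousLaplacian σ l).finrank_range_add_finrank_ker
  rw [LinearMap.range_eq_top.mpr (homogeneousLaplacian_surjective σ l), finrank_top] at h
  rw [← h]
  congr 1
  have hker : (LinearMap.ker (homogeneousLaplacian σ l)).map
      (MvPolynomial.homogeneousSubmodule σ ℝ (l + 2)).subtype = harmonicSubmodule σ (l + 2) := by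
    ext p
    simp only [Submodule.mem_map, LinearMap.mem_ker, Submodule.subtype_apply,
      mem_harmonicSubmodule]
    constructor
    · rintro ⟨q, hq, rfl⟩
      exact ⟨q.2, congrArg Subtype.val hq⟩
    · rintro ⟨h1, h2⟩
      exact ⟨⟨p, h1⟩, Subtype.ext h2, rfl⟩
  rw [← hker]
  exact Submodule.finrank_map_subtype_eq _ _

theorem finrank_homogeneousSubmodule (d l : ℕ) :
    Module.finrank ℝ (MvPolynomial.homogeneousSubmodule (Fin (d + 1)) ℝ l) = (l + d).choose d := by
  classical
  rw [MvPolynomial.homogeneousSubmodule_eq_finsupp_supported,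
    (AddMonoidAlgebra.supportedEquivFinsupp (R := ℝ) (S := ℝ)
      {α : Fin (d + 1) →₀ ℕ | α.degree = l}).finrank_eq]
  have hset : {α : Fin (d + 1) →₀ ℕ | α.degree = l} =
      ((Finset.univ.finsuppAntidiag l : Finset (Fin (d + 1) →₀ ℕ)) : Set (Fin (d + 1) →₀ ℕ)) := by
    ext α
    simp [Finset.mem_finsuppAntidiag, Finsupp.degree_eq_sum]
  rw [hset, Module.finrank_finsupp_self]
  simp only [Finset.coe_sort_coe, Fintype.card_coe, Finset.card_finsuppAntidiag_nat_eq_choose,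
    Finset.card_univ, Fintype.card_fin]
  rw [show d + 1 + l - 1 = l + d by omega, Nat.choose_symm_add]

theorem sum_finrank_harmonicSubmodule {d : ℕ} (hd : 1 ≤ d) (l : ℕ) :
    ∑ k ∈ Finset.range (l + 1), Module.finrank ℝ (harmonicSubmodule (Fin (d + 1)) k) =
      levelCount d l := by
  induction l with
  | zero =>
    rw [Finset.sum_range_one, harmonicSubmodule_of_lt_two _ zero_lt_two,
      finrank_homogeneousSubmodule, levelCount,
      Nat.choose_eq_zero_of_lt (n := 0 + d - 1) (by omega)]
    simp
  | succ l ih =>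
    rw [Finset.sum_range_succ, ih, levelCount, levelCount]
    cases l with
    | zero =>
      rw [zero_add, harmonicSubmodule_of_lt_two _ one_lt_two, finrank_homogeneousSubmodule,
        Nat.choose_eq_zero_of_lt (n := 0 + d - 1) (by omega), add_zero, add_comm,
        show 1 + 1 + d - 1 = 1 + d by omega]
    | succ l =>
      have h := finrank_harmonicSubmodule_add (Fin (d + 1)) l
      rw [finrank_homogeneousSubmodule, finrank_homogeneousSubmodule] at h
      rw [show l + 1 + 1 + 1 + d - 1 = l + 2 + d by omega, show l + 1 + d - 1 = l + d by omega, ← h]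
      ring

/-- Every polynomial is a sum of products of powers of `|x|²` with homogeneous harmonic
polynomials. -/
theorem mem_of_harmonicSubmodule_le {σ : Type*} [Fintype σ] [Nonempty σ]
    {V : Submodule ℝ (MvPolynomial σ ℝ)} (hV : ∀ l, harmonicSubmodule σ l ≤ V)
    (hmul : ∀ q ∈ V, normSqPoly σ * q ∈ V) (p : MvPolynomial σ ℝ) : p ∈ V := by
  have hhom : ∀ (l : ℕ) (p : MvPolynomial σ ℝ), p.IsHomogeneous l → p ∈ V := by
    intro l
    induction l using Nat.strong_induction_on with
    | _ l ih =>
      intro p hp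
      rcases lt_or_ge l 2 with hl | hl
      · exact hV l ⟨hp, polyLaplacian_eq_zero_of_lt_two hl hp⟩
      · obtain ⟨l, rfl⟩ := Nat.exists_eq_add_of_le' hl
        obtain ⟨q, hq, hqp⟩ := exists_polyLaplacian_normSqPoly_mul (polyLaplacian_isHomogeneous hp)
        have hnq := (normSqPoly_isHomogeneous σ).mul hq
        rw [add_comm] at hnq
        have hmem : p - normSqPoly σ * q ∈ harmonicSubmodule σ (l + 2) :=
          mem_harmonicSubmodule.mpr ⟨hp.sub hnq, by rw [map_sub, hqp, sub_self]⟩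
        rw [← sub_add_cancel p (normSqPoly σ * q)]
        exact V.add_mem (hV _ hmem) (hmul q (ih l (by omega) q hq))
  rw [← p.sum_homogeneousComponent]
  exact V.sum_mem fun l _ => hhom l _ (MvPolynomial.homogeneousComponent_isHomogeneous l p)

/-! ### Computing with the Laplacian -/

theorem fderiv_apply_self_of_forall_smul {E : Type*} [NormedAddCommGroup E] [NormedSpace ℝ E]
    {g : E → ℝ} {x : E} (hg : DifferentiableAt ℝ g x)
    (h : ∀ c : ℝ, 0 < c → g (c • x) = g x) : fderiv ℝ g x x = 0 := by
  have h1 : HasDerivAt (fun c : ℝ => c • x) x 1 := by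
    simpa using (hasDerivAt_id (1 : ℝ)).smul_const x
  have h2 : HasDerivAt (fun c : ℝ => g (c • x)) (fderiv ℝ g x x) 1 :=
    HasFDerivAt.comp_hasDerivAt_of_eq (1 : ℝ) hg.hasFDerivAt h1 (one_smul ℝ x).symm
  have h3 : HasDerivAt (fun c : ℝ => g (c • x)) 0 1 := by
    refine (hasDerivAt_const (1 : ℝ) (g x)).congr_of_eventuallyEq ?_
    filter_upwards [lt_mem_nhds zero_lt_one] with c hc using h c hc
  exact h2.unique h3

theorem hasFDerivAt_comp_norm_sq {E : Type*} [NormedAddCommGroup E] [InnerProductSpace ℝ E]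
    {ρ : ℝ → ℝ} {c : ℝ} {y : E}
    (h : HasDerivAt ρ c (‖y‖ ^ 2)) :
    HasFDerivAt (fun y : E => ρ (‖y‖ ^ 2)) ((2 * c) • innerSL ℝ y) y := by
  have := h.comp_hasFDerivAt y (hasStrictFDerivAt_norm_sq y).hasFDerivAt
  refine this.congr_fderiv ?_
  ext z
  simp
  ring

section LaplacianCalculus

variable {E : Type*} [NormedAddCommGroup E] [InnerProductSpace ℝ E] [FiniteDimensional ℝ E]

theorem laplacian_eq_sum_fderiv {ι : Type*} [Fintype ι] (v : OrthonormalBasis ι ℝ E) (f : E → ℝ)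
    (x : E) : Δ f x = ∑ i, fderiv ℝ (fderiv ℝ f) x (v i) (v i) := by
  rw [laplacian_eq_iteratedFDeriv_orthonormalBasis f v]
  exact Finset.sum_congr rfl fun i _ => iteratedFDeriv_two_apply f x _

/-- The Laplacian from first partial derivatives `f' i` near `x` and second ones at `x`. -/
theorem laplacian_eq_of_hasFDerivAt {ι : Type*} [Fintype ι] (v : OrthonormalBasis ι ℝ E)
    {f : E → ℝ} {f' : E → E →L[ℝ] ℝ} {f'' : ι → E →L[ℝ] ℝ} {x : E}
    (hf : ContDiffAt ℝ 2 f x) (h1 : ∀ᶠ y in 𝓝 x, HasFDerivAt f (f' y) y)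
    (h2 : ∀ i, HasFDerivAt (fun y => f' y (v i)) (f'' i) x) :
    Δ f x = ∑ i, f'' i (v i) := by
  rw [laplacian_eq_sum_fderiv v]
  refine Finset.sum_congr rfl fun i _ => ?_
  have hd : DifferentiableAt ℝ (fderiv ℝ f) x :=
    (hf.fderiv_right (m := 1) (by norm_num)).differentiableAt (by norm_num)
  have h3 : HasFDerivAt (fun y => fderiv ℝ f y (v i))
      ((fderiv ℝ (fderiv ℝ f) x).flip (v i)) x := by
    simpa using hd.hasFDerivAt.clm_apply (hasFDerivAt_const (v i) x)
  have h4 : (fun y => fderiv ℝ f y (v i)) =ᶠ[𝓝 x] fun y => f' y (v i) := by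
    filter_upwards [h1] with y hy
    rw [hy.fderiv]
  have := (h3.congr_of_eventuallyEq h4.symm).unique (h2 i)
  rw [← this]
  rfl

theorem laplacian_mul {ι : Type*} [Fintype ι] (v : OrthonormalBasis ι ℝ E) {f g : E → ℝ} {x : E}
    (hf : ContDiffAt ℝ 2 f x) (hg : ContDiffAt ℝ 2 g x) :
    Δ (fun y => f y * g y) x =
      f x * Δ g x + g x * Δ f x + 2 * ∑ i, fderiv ℝ f x (v i) * fderiv ℝ g x (v i) := by
  have hd : ∀ {h : E → ℝ}, ContDiffAt ℝ 2 h x → ∀ᶠ y in 𝓝 x, DifferentiableAt ℝ h y :=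
    fun hh => (hh.eventually (by norm_num)).mono fun y hy => hy.differentiableAt (by norm_num)
  have hdd : ∀ {h : E → ℝ}, ContDiffAt ℝ 2 h x → ∀ e, HasFDerivAt (fun y => fderiv ℝ h y e)
      ((fderiv ℝ (fderiv ℝ h) x).flip e) x := fun hh e => by
    have : DifferentiableAt ℝ (fderiv ℝ _) x :=
      (hh.fderiv_right (m := 1) (by norm_num)).differentiableAt (by norm_num)
    simpa using this.hasFDerivAt.clm_apply (hasFDerivAt_const e x)
  have h1 : ∀ᶠ y in 𝓝 x, HasFDerivAt (fun y => f y * g y)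
      (f y • fderiv ℝ g y + g y • fderiv ℝ f y) y := by
    filter_upwards [hd hf, hd hg] with y hy1 hy2
    exact hy1.hasFDerivAt.mul hy2.hasFDerivAt
  have h2 : ∀ i, HasFDerivAt
      (fun y => (f y • fderiv ℝ g y + g y • fderiv ℝ f y) (v i))
      ((f x • (fderiv ℝ (fderiv ℝ g) x).flip (v i) + fderiv ℝ g x (v i) • fderiv ℝ f x) +
        (g x • (fderiv ℝ (fderiv ℝ f) x).flip (v i) + fderiv ℝ f x (v i) • fderiv ℝ g x)) x :=
    fun i => ((hd hf).self_of_nhds.hasFDerivAt.mul (hdd hg (v i))).add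
      ((hd hg).self_of_nhds.hasFDerivAt.mul (hdd hf (v i)))
  rw [laplacian_eq_of_hasFDerivAt v (hf.mul hg) h1 h2, laplacian_eq_sum_fderiv v f,
    laplacian_eq_sum_fderiv v g, Finset.mul_sum, Finset.mul_sum, Finset.mul_sum,
    ← Finset.sum_add_distrib, ← Finset.sum_add_distrib]
  refine Finset.sum_congr rfl fun i _ => ?_
  simp only [_root_.add_apply, _root_.smul_apply,
    ContinuousLinearMap.flip_apply, smul_eq_mul]
  ring

theorem laplacian_comp_norm_sq {ρ ρ' : ℝ → ℝ} {c : ℝ} {x : E} (hρ : ContDiffAt ℝ 2 ρ (‖x‖ ^ 2))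
    (h1 : ∀ᶠ t in 𝓝 (‖x‖ ^ 2), HasDerivAt ρ (ρ' t) t) (h2 : HasDerivAt ρ' c (‖x‖ ^ 2)) :
    Δ (fun y : E => ρ (‖y‖ ^ 2)) x =
      4 * ‖x‖ ^ 2 * c + 2 * Module.finrank ℝ E * ρ' (‖x‖ ^ 2) := by
  have hc : ContDiffAt ℝ 2 (fun y : E => ρ (‖y‖ ^ 2)) x :=
    hρ.comp x (contDiff_norm_sq ℝ).contDiffAt
  have hcont : Tendsto (fun y : E => ‖y‖ ^ 2) (𝓝 x) (𝓝 (‖x‖ ^ 2)) :=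
    (continuous_norm.pow 2).continuousAt
  have h3 : ∀ᶠ y in 𝓝 x, HasFDerivAt (fun y : E => ρ (‖y‖ ^ 2))
      ((2 * ρ' (‖y‖ ^ 2)) • innerSL ℝ y) y :=
    (hcont.eventually h1).mono fun y hy => hasFDerivAt_comp_norm_sq hy
  let v := stdOrthonormalBasis ℝ E
  have h4 : ∀ i, HasFDerivAt (fun y : E => ((2 * ρ' (‖y‖ ^ 2)) • innerSL ℝ y) (v i))
      ((2 * ρ' (‖x‖ ^ 2)) • innerSL ℝ (v i) +
        inner ℝ (v i) x • ((2 : ℝ) • ((2 * c) • innerSL ℝ x))) x := by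
    intro i
    have h5 : HasFDerivAt (fun y : E => innerSL ℝ (v i) y) (innerSL ℝ (v i)) x :=
      (innerSL ℝ (v i)).hasFDerivAt
    have h6 := ((hasFDerivAt_comp_norm_sq h2).const_mul 2).mul h5
    refine h6.congr_of_eventuallyEq (Eventually.of_forall fun y => ?_)
    simp [real_inner_comm]
  rw [laplacian_eq_of_hasFDerivAt v hc h3 h4]
  have h7 := v.sum_sq_norm_inner_right x
  have h8 : ∀ i, ((2 * ρ' (‖x‖ ^ 2)) • innerSL ℝ (v i) +
        inner ℝ (v i) x • ((2 : ℝ) • ((2 * c) • innerSL ℝ x))) (v i) =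
      2 * ρ' (‖x‖ ^ 2) + 4 * c * ‖inner ℝ (v i) x‖ ^ 2 := by
    intro i
    simp only [_root_.add_apply, _root_.smul_apply, innerSL_apply_apply,
      smul_eq_mul, real_inner_self_eq_norm_sq, v.norm_eq_one, real_inner_comm (v i) x,
      Real.norm_eq_abs, sq_abs]
    ring
  rw [Finset.sum_congr rfl fun i _ => h8 i, Finset.sum_add_distrib,
    ← Finset.mul_sum Finset.univ _ (4 * c), h7]
  simp only [Finset.sum_const, Finset.card_univ, Fintype.card_fin, nsmul_eq_mul]
  ring

/-- The product rule for the Laplacian with a radial factor `ρ(|y|²)`: the mixed term is a radial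
derivative. -/
theorem laplacian_radial_mul {ρ : ℝ → ℝ} {g : E → ℝ} {x : E} (hρ : ContDiffAt ℝ 2 ρ (‖x‖ ^ 2))
    (hg : ContDiffAt ℝ 2 g x) :
    Δ (fun y => ρ (‖y‖ ^ 2) * g y) x = ρ (‖x‖ ^ 2) * Δ g x +
      g x * Δ (fun y : E => ρ (‖y‖ ^ 2)) x + 4 * deriv ρ (‖x‖ ^ 2) * fderiv ℝ g x x := by
  let v := stdOrthonormalBasis ℝ E
  have hc : ContDiffAt ℝ 2 (fun y : E => ρ (‖y‖ ^ 2)) x :=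
    hρ.comp x (contDiff_norm_sq ℝ).contDiffAt
  rw [laplacian_mul v hc hg,
    (hasFDerivAt_comp_norm_sq (hρ.differentiableAt (by norm_num)).hasDerivAt).fderiv]
  have h : fderiv ℝ g x x = ∑ i, inner ℝ x (v i) * fderiv ℝ g x (v i) := by
    conv_lhs => rw [← v.sum_repr' x]
    simp only [map_sum, map_smul, smul_eq_mul]
    rw [v.sum_repr' x]
    exact Finset.sum_congr rfl fun i _ => by rw [real_inner_comm]
  rw [h, Finset.mul_sum, Finset.mul_sum]
  congr 1
  refine Finset.sum_congr rfl fun i _ => ?_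
  simp only [_root_.smul_apply, innerSL_apply_apply, smul_eq_mul]
  ring

theorem laplacian_of_forall_smul {g : E → ℝ} {c : ℝ} (h : ∀ y, g (c • y) = g y) (x : E) :
    Δ g x = c ^ 2 * Δ g (c • x) := by
  let v := stdOrthonormalBasis ℝ E
  have h1 : fderiv ℝ g = fun y => c • fderiv ℝ g (c • y) := by
    funext y
    conv_lhs => rw [show g = fun y => g (c • y) from funext fun y => (h y).symm]
    exact fderiv_comp_smul c
  have h2 : fderiv ℝ (fderiv ℝ g) x = c • c • fderiv ℝ (fderiv ℝ g) (c • x) := by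
    conv_lhs => rw [h1]
    have h3 := congrFun (fderiv_const_smul_field (𝕜 := ℝ) (f := fun y => fderiv ℝ g (c • y)) c) x
    refine h3.trans ?_
    rw [Pi.smul_apply, fderiv_comp_smul]
  rw [laplacian_eq_sum_fderiv v, laplacian_eq_sum_fderiv v, h2, Finset.mul_sum]
  refine Finset.sum_congr rfl fun i _ => ?_
  simp only [_root_.smul_apply, smul_eq_mul]
  ring

end LaplacianCalculus

/-! ### Polynomial functions on Euclidean space -/

theorem hasFDerivAt_eval {ι : Type*} [Fintype ι] (p : MvPolynomial ι ℝ)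
    (x : EuclideanSpace ℝ ι) :
    HasFDerivAt (fun y : EuclideanSpace ℝ ι => MvPolynomial.eval (fun i => y i) p)
      (∑ i, MvPolynomial.eval (fun i => x i) (MvPolynomial.pderiv i p) •
        (EuclideanSpace.proj i : EuclideanSpace ℝ ι →L[ℝ] ℝ)) x := by
  classical
  induction p using MvPolynomial.induction_on with
  | C a =>
    simp only [MvPolynomial.eval_C, MvPolynomial.pderiv_C, map_zero, zero_smul,
      Finset.sum_const_zero]
    exact hasFDerivAt_const _ _
  | add p q hp hq =>
    simp only [map_add, add_smul, Finset.sum_add_distrib]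
    exact hp.add hq
  | mul_X p j hp =>
    have hX : HasFDerivAt (fun y : EuclideanSpace ℝ ι => y j)
        (EuclideanSpace.proj j : EuclideanSpace ℝ ι →L[ℝ] ℝ) x :=
      (EuclideanSpace.proj j : EuclideanSpace ℝ ι →L[ℝ] ℝ).hasFDerivAt
    have h := hp.mul hX
    simp only [map_mul, MvPolynomial.eval_X]
    refine h.congr_fderiv ?_
    ext z
    simp only [MvPolynomial.pderiv_mul, MvPolynomial.pderiv_X, map_add, map_mul,
      MvPolynomial.eval_X, Pi.single_apply, apply_ite (MvPolynomial.eval fun i => x i),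
      map_zero, mul_ite, mul_one, mul_zero, _root_.add_apply,
      _root_.smul_apply, _root_.sum_apply, smul_eq_mul, add_mul, ite_mul,
      zero_mul, Finset.sum_add_distrib, Finset.sum_ite_eq, Finset.mem_univ, if_true, Finset.mul_sum]
    rw [add_comm]
    congr 1
    exact Finset.sum_congr rfl fun i _ => by ring

theorem contDiff_eval {ι : Type*} [Fintype ι] (p : MvPolynomial ι ℝ) :
    ContDiff ℝ ∞ fun y : EuclideanSpace ℝ ι => MvPolynomial.eval (fun i => y i) p := by
  induction p using MvPolynomial.induction_on with
  | C a => simpa using contDiff_const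
  | add p q hp hq => simpa using hp.add hq
  | mul_X p j hp =>
    simp only [map_mul, MvPolynomial.eval_X]
    exact hp.mul (EuclideanSpace.proj j : EuclideanSpace ℝ ι →L[ℝ] ℝ).contDiff

theorem laplacian_eval {ι : Type*} [Fintype ι] (p : MvPolynomial ι ℝ) (x : EuclideanSpace ℝ ι) :
    Δ (fun y : EuclideanSpace ℝ ι => MvPolynomial.eval (fun i => y i) p) x =
      MvPolynomial.eval (fun i => x i) (polyLaplacian ι p) := by
  classical
  have hv : ∀ (q : ι → ℝ) (i : ι), (∑ j, q j •
      (EuclideanSpace.proj j : EuclideanSpace ℝ ι →L[ℝ] ℝ)) (EuclideanSpace.basisFun ι ℝ i) =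
        q i := by
    intro q i
    simp
  rw [laplacian_eq_of_hasFDerivAt (EuclideanSpace.basisFun ι ℝ)
    ((contDiff_eval p).contDiffAt.of_le (by norm_cast))
    (Eventually.of_forall fun y => hasFDerivAt_eval p y)
    (f'' := fun i => ∑ j, MvPolynomial.eval (fun i => x i)
      (MvPolynomial.pderiv j (MvPolynomial.pderiv i p)) •
        (EuclideanSpace.proj j : EuclideanSpace ℝ ι →L[ℝ] ℝ))
    (fun i => by
      simp only [hv (fun j => MvPolynomial.eval _ (MvPolynomial.pderiv j p)) i]
      exact hasFDerivAt_eval (MvPolynomial.pderiv i p) x)]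
  rw [polyLaplacian_apply, map_sum]
  exact Finset.sum_congr rfl fun i _ => hv _ i

theorem fderiv_eval_apply_self {ι : Type*} [Fintype ι] {p : MvPolynomial ι ℝ} {l : ℕ}
    (hp : p.IsHomogeneous l) (x : EuclideanSpace ℝ ι) :
    fderiv ℝ (fun y : EuclideanSpace ℝ ι => MvPolynomial.eval (fun i => y i) p) x x =
      l * MvPolynomial.eval (fun i => x i) p := by
  rw [(hasFDerivAt_eval p x).fderiv]
  have h := congrArg (MvPolynomial.eval fun i => x i) hp.sum_X_mul_pderiv
  simp only [map_sum, map_mul, MvPolynomial.eval_X, nsmul_eq_mul, map_natCast] at h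
  rw [← h]
  simp only [_root_.sum_apply, _root_.smul_apply, smul_eq_mul]
  exact Finset.sum_congr rfl fun i _ => by rw [mul_comm]; rfl

theorem eval_smul_of_isHomogeneous {ι : Type*} {p : MvPolynomial ι ℝ} {l : ℕ}
    (hp : p.IsHomogeneous l) (c : ℝ) (x : ι → ℝ) :
    MvPolynomial.eval (fun i => c * x i) p = c ^ l * MvPolynomial.eval x p := by
  rw [MvPolynomial.eval_eq, MvPolynomial.eval_eq, Finset.mul_sum]
  refine Finset.sum_congr rfl fun α hα => ?_
  have h : ∏ i ∈ α.support, c ^ α i = c ^ l := by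
    rw [Finset.prod_pow_eq_pow_sum, hp.degree_eq_sum_deg_support hα]
  simp only [mul_pow, Finset.prod_mul_distrib, h]
  ring

/-! ### Spherical harmonics are eigenfunctions -/

theorem radialExtension_of_ne_zero {d : ℕ} (f : RoundSphere d → ℝ) {y : AmbientSpace d}
    (hy : y ≠ 0) : radialExtension d f y = f ⟨‖y‖⁻¹ • y, by
      rw [mem_sphere_zero_iff_norm, norm_smul, norm_inv, norm_norm,
        inv_mul_cancel₀ (norm_ne_zero_iff.mpr hy)]⟩ :=
  dif_pos hy

theorem radialExtension_coe {d : ℕ} (f : RoundSphere d → ℝ) (x : RoundSphere d) :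
    radialExtension d f x = f x := by
  rw [radialExtension_of_ne_zero f (ne_zero_of_mem_unit_sphere x)]
  congr 1
  ext1
  simp

theorem radialExtension_smul_of_pos {d : ℕ} (f : RoundSphere d → ℝ) {c : ℝ} (hc : 0 < c)
    (y : AmbientSpace d) : radialExtension d f (c • y) = radialExtension d f y := by
  rcases eq_or_ne y 0 with rfl | hy
  · rw [smul_zero]
  · rw [radialExtension_of_ne_zero f hy, radialExtension_of_ne_zero f (smul_ne_zero hc.ne' hy)]
    congr 2
    rw [norm_smul, Real.norm_of_nonneg hc.le, smul_smul, mul_inv, mul_right_comm,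
      inv_mul_cancel₀ hc.ne', one_mul]

theorem radialExtension_mul {d : ℕ} (f g : RoundSphere d → ℝ) (y : AmbientSpace d) :
    radialExtension d (f * g) y = radialExtension d f y * radialExtension d g y := by
  by_cases hy : y = 0 <;> simp [radialExtension, hy]

/-- The radial extension `F` of an eigenfunction for `μ` satisfies `ΔF = -μ |y|⁻² F`. -/
theorem laplacian_radialExtension {d : ℕ} {f : RoundSphere d → ℝ} {μ : ℝ}
    (hf : f ∈ laplaceEigenspace d μ) {y : AmbientSpace d} (hy : y ≠ 0) :
    Δ (radialExtension d f) y = -(μ * ‖y‖⁻¹ ^ 2) * radialExtension d f y := by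
  have hy' : 0 < ‖y‖⁻¹ := inv_pos.mpr (norm_pos_iff.mpr hy)
  rw [laplacian_of_forall_smul (fun z => radialExtension_smul_of_pos f hy' z) y,
    radialExtension_of_ne_zero f hy]
  have h := hf.2 ⟨‖y‖⁻¹ • y, by
      rw [mem_sphere_zero_iff_norm, norm_smul, norm_inv, norm_norm,
        inv_mul_cancel₀ (norm_ne_zero_iff.mpr hy)]⟩
  simp only [sphereLaplacian] at h
  linear_combination (-‖y‖⁻¹ ^ 2) * h

/-- The restriction of polynomials to the unit sphere. -/
noncomputable def restrictSphere (d : ℕ) :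
    MvPolynomial (Fin (d + 1)) ℝ →ₗ[ℝ] (RoundSphere d → ℝ) where
  toFun p x := MvPolynomial.eval (fun i => (x : AmbientSpace d) i) p
  map_add' p q := by ext x; simp
  map_smul' c p := by ext x; simp [MvPolynomial.smul_eval]

theorem restrictSphere_apply {d : ℕ} (p : MvPolynomial (Fin (d + 1)) ℝ) (x : RoundSphere d) :
    restrictSphere d p x = MvPolynomial.eval (fun i => (x : AmbientSpace d) i) p := rfl

theorem contMDiff_restrictSphere {d : ℕ} (p : MvPolynomial (Fin (d + 1)) ℝ) :
    ContMDiff (𝓡 d) 𝓘(ℝ, ℝ) ∞ (restrictSphere d p) := by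
  have := Fact.mk (@finrank_euclideanSpace_fin ℝ _ (d + 1))
  exact (contDiff_eval p).contMDiff.comp (contMDiff_coe_sphere (n := d) (E := AmbientSpace d))

theorem radialExtension_restrictSphere {d l : ℕ} {p : MvPolynomial (Fin (d + 1)) ℝ}
    (hp : p.IsHomogeneous l) {y : AmbientSpace d} (hy : y ≠ 0) :
    radialExtension d (restrictSphere d p) y =
      (‖y‖ ^ 2) ^ (-(l : ℝ) / 2) * MvPolynomial.eval (fun i => y i) p := by
  have hy' : 0 < ‖y‖ := norm_pos_iff.mpr hy
  rw [radialExtension_of_ne_zero _ hy, restrictSphere_apply]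
  have h := eval_smul_of_isHomogeneous hp ‖y‖⁻¹ (fun i => y i)
  have h2 : (‖y‖ ^ 2) ^ (-(l : ℝ) / 2) = ‖y‖⁻¹ ^ l := by
    rw [← Real.rpow_natCast ‖y‖ 2, ← Real.rpow_mul hy'.le, inv_pow, ← Real.rpow_natCast,
      ← Real.rpow_neg hy'.le]
    congr 1
    push_cast
    ring
  rw [h2, ← h]
  rfl

/-- The restriction of a homogeneous harmonic polynomial of degree `l` is an eigenfunction. -/
theorem restrictSphere_mem_laplaceEigenspace {d l : ℕ} {p : MvPolynomial (Fin (d + 1)) ℝ}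
    (hp : p ∈ harmonicSubmodule (Fin (d + 1)) l) :
    restrictSphere d p ∈ laplaceEigenspace d (energyLevel d l) := by
  refine ⟨contMDiff_restrictSphere p, fun x => ?_⟩
  obtain ⟨hp1, hp2⟩ := mem_harmonicSubmodule.mp hp
  have hx0 : (x : AmbientSpace d) ≠ 0 := ne_zero_of_mem_unit_sphere x
  have hx1 : ‖(x : AmbientSpace d)‖ ^ 2 = 1 := by rw [norm_eq_of_mem_sphere x, one_pow]
  have hpow : ∀ (s t : ℝ), t ≠ 0 → HasDerivAt (fun t : ℝ => t ^ s) (s * t ^ (s - 1)) t :=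
    fun s t ht => Real.hasDerivAt_rpow_const (Or.inl ht)
  have hρ : ContDiffAt ℝ 2 (fun t : ℝ => t ^ (-(l : ℝ) / 2)) (‖(x : AmbientSpace d)‖ ^ 2) := by
    rw [hx1]
    exact Real.contDiffAt_rpow_const_of_ne one_ne_zero
  have hev : radialExtension d (restrictSphere d p) =ᶠ[𝓝 (x : AmbientSpace d)]
      fun y => (fun t : ℝ => t ^ (-(l : ℝ) / 2)) (‖y‖ ^ 2) *
        MvPolynomial.eval (fun i => y i) p := by
    filter_upwards [isOpen_ne.mem_nhds hx0] with y hy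
    exact radialExtension_restrictSphere hp1 hy
  have hΔρ := laplacian_comp_norm_sq (x := (x : AmbientSpace d)) hρ
    (ρ' := fun t => -(l : ℝ) / 2 * t ^ (-(l : ℝ) / 2 - 1))
    (c := -(l : ℝ) / 2 * (-(l : ℝ) / 2 - 1))
    (by
      rw [hx1]
      filter_upwards [isOpen_ne.mem_nhds (one_ne_zero (α := ℝ))] with t ht
      exact hpow _ t ht)
    (by
      rw [hx1]
      simpa using (hpow (-(l : ℝ) / 2 - 1) 1 one_ne_zero).const_mul (-(l : ℝ) / 2))
  rw [sphereLaplacian, (laplacian_congr_nhds hev).self_of_nhds, laplacian_radial_mul hρ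
    ((contDiff_eval p).contDiffAt.of_le (by norm_cast)), laplacian_eval, hp2, hΔρ,
    fderiv_eval_apply_self hp1, restrictSphere_apply, hx1, (hpow _ 1 one_ne_zero).deriv]
  simp only [Real.one_rpow, map_zero, finrank_euclideanSpace, Fintype.card_fin, energyLevel]
  push_cast
  ring

theorem restrictSphere_injOn {d l : ℕ} {p : MvPolynomial (Fin (d + 1)) ℝ}
    (hp : p.IsHomogeneous l) (h : restrictSphere d p = 0) : p = 0 := by
  have h1 : ∀ y : AmbientSpace d, y ≠ 0 → MvPolynomial.eval (fun i => y i) p = 0 := by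
    intro y hy
    have h2 := radialExtension_restrictSphere hp hy
    rw [h, radialExtension_of_ne_zero _ hy, Pi.zero_apply] at h2
    have h3 : 0 < (‖y‖ ^ 2) ^ (-(l : ℝ) / 2) :=
      Real.rpow_pos_of_pos (pow_pos (norm_pos_iff.mpr hy) 2) _
    exact (mul_eq_zero.mp h2.symm).resolve_left h3.ne'
  -- a continuous function vanishing off the origin vanishes
  have h4 : (fun y : AmbientSpace d => MvPolynomial.eval (fun i => y i) p) = fun _ => 0 := by
    refine Continuous.ext_on (dense_compl_singleton (0 : AmbientSpace d))
      (contDiff_eval p).continuous continuous_const fun y hy => h1 y hy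
  refine MvPolynomial.funext fun x => ?_
  rw [map_zero]
  exact congrFun h4 (WithLp.toLp 2 x)

/-! ### Orthogonality of eigenfunctions -/

/-- A smooth bump function on the line, supported in `[1/2, 3/2]`. -/
noncomputable def annulusBump : ContDiffBump (1 : ℝ) where
  rIn := 1 / 4
  rOut := 1 / 2
  rIn_pos := by norm_num
  rIn_lt_rOut := by norm_num

/-- A smooth radial function on `ℝ^(d+1)`, compactly supported off the origin. -/
noncomputable def radialCutoff (d : ℕ) (y : AmbientSpace d) : ℝ := annulusBump (‖y‖ ^ 2)

theorem radialCutoff_contDiff (d : ℕ) : ContDiff ℝ ∞ (radialCutoff d) :=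
  annulusBump.contDiff.comp (contDiff_norm_sq ℝ)

theorem radialCutoff_eventuallyEq_zero (d : ℕ) : radialCutoff d =ᶠ[𝓝 0] 0 := by
  filter_upwards [Metric.ball_mem_nhds (0 : AmbientSpace d) (ε := 1 / 2) (by norm_num)] with y hy
  have hy' : ‖y‖ < 1 / 2 := by simpa using hy
  refine annulusBump.zero_of_le_dist ?_
  have h1 : ‖y‖ ^ 2 ≤ 1 / 2 := by nlinarith [norm_nonneg y]
  rw [Real.dist_eq, abs_of_nonpos (by linarith)]
  change 1 / 2 ≤ _
  linarith

theorem radialCutoff_hasCompactSupport (d : ℕ) : HasCompactSupport (radialCutoff d) := by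
  refine HasCompactSupport.intro (isCompact_closedBall (0 : AmbientSpace d) 2) fun y hy => ?_
  have hy' : 2 < ‖y‖ := by simpa using hy
  refine annulusBump.zero_of_le_dist ?_
  have h1 : 3 / 2 ≤ ‖y‖ ^ 2 := by nlinarith
  rw [Real.dist_eq, abs_of_nonneg (by linarith)]
  change 1 / 2 ≤ _
  linarith

theorem radialCutoff_coe {d : ℕ} (x : RoundSphere d) : radialCutoff d x = 1 := by
  rw [radialCutoff, norm_eq_of_mem_sphere x, one_pow]
  exact annulusBump.one_of_mem_closedBall (Metric.mem_closedBall_self annulusBump.rIn_pos.le)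

theorem contDiff_radialCutoff_mul {d : ℕ} {G : AmbientSpace d → ℝ}
    (hG : ∀ y, y ≠ 0 → ContDiffAt ℝ ∞ G y) : ContDiff ℝ ∞ fun y => radialCutoff d y * G y := by
  refine contDiff_iff_contDiffAt.mpr fun y => ?_
  rcases eq_or_ne y 0 with rfl | hy
  · refine (contDiffAt_const (c := (0 : ℝ))).congr_of_eventuallyEq ?_
    filter_upwards [radialCutoff_eventuallyEq_zero d] with y hy
    rw [hy, Pi.zero_apply, zero_mul]
  · exact (radialCutoff_contDiff d).contDiffAt.mul (hG y hy)

theorem continuous_radialCutoff_mul {d : ℕ} {G : AmbientSpace d → ℝ}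
    (hG : ∀ y, y ≠ 0 → ContinuousAt G y) : Continuous fun y => radialCutoff d y * G y := by
  refine continuous_iff_continuousAt.mpr fun y => ?_
  rcases eq_or_ne y 0 with rfl | hy
  · refine (continuousAt_const (y := (0 : ℝ))).congr ?_
    filter_upwards [radialCutoff_eventuallyEq_zero d] with y hy
    rw [hy, Pi.zero_apply, zero_mul]
  · exact (radialCutoff_contDiff d).continuous.continuousAt.mul (hG y hy)

theorem continuousAt_radialExtension {d : ℕ} {f : RoundSphere d → ℝ} (hf : Continuous f)
    {y : AmbientSpace d} (hy : y ≠ 0) : ContinuousAt (radialExtension d f) y := by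
  have h1 : IsOpen {y : AmbientSpace d | y ≠ 0} := isOpen_ne
  have h2 : ContinuousOn (radialExtension d f) {y : AmbientSpace d | y ≠ 0} := by
    rw [continuousOn_iff_continuous_domRestrict]
    have h3 : Continuous fun y : {y : AmbientSpace d | y ≠ 0} =>
        ‖(y : AmbientSpace d)‖⁻¹ • (y : AmbientSpace d) :=
      (continuous_subtype_val.norm.inv₀ fun y => norm_ne_zero_iff.mpr y.2).smul
        continuous_subtype_val
    have h4 := hf.comp (h3.subtype_mk fun y => by
      rw [mem_sphere_zero_iff_norm, norm_smul, norm_inv, norm_norm,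
        inv_mul_cancel₀ (norm_ne_zero_iff.mpr y.2)])
    refine h4.congr fun y => ?_
    exact (radialExtension_of_ne_zero f y.2).symm
  exact h2.continuousAt (h1.mem_nhds hy)

/-- The radial extension of a function on the sphere, multiplied by the weight `φ(y)² / |y|²` with
the radial cutoff `φ`. The factor `|y|⁻²` is the one in `ΔF(y) = |y|⁻² (Δ_𝕊 f)(y / |y|)`. -/
noncomputable def annulusIntegrand (d : ℕ) (f : RoundSphere d → ℝ) (y : AmbientSpace d) : ℝ :=
  radialCutoff d y * (radialCutoff d y * ‖y‖⁻¹ ^ 2 * radialExtension d f y)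

theorem annulusIntegrand_continuous {d : ℕ} {f : RoundSphere d → ℝ} (hf : Continuous f) :
    Continuous (annulusIntegrand d f) :=
  continuous_radialCutoff_mul fun _ hy =>
    ((radialCutoff_contDiff d).continuous.continuousAt.mul
      ((continuous_norm.continuousAt.inv₀ (norm_ne_zero_iff.mpr hy)).pow 2)).mul
        (continuousAt_radialExtension hf hy)

theorem annulusIntegrand_hasCompactSupport {d : ℕ} (f : RoundSphere d → ℝ) :
    HasCompactSupport (annulusIntegrand d f) :=
  (radialCutoff_hasCompactSupport d).mul_right

theorem annulusIntegrand_integrable {d : ℕ} {f : RoundSphere d → ℝ} (hf : Continuous f) :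
    Integrable (annulusIntegrand d f) :=
  (annulusIntegrand_continuous hf).integrable_of_hasCompactSupport
    (annulusIntegrand_hasCompactSupport f)

theorem annulusIntegrand_coe {d : ℕ} (f : RoundSphere d → ℝ) (x : RoundSphere d) :
    annulusIntegrand d f x = f x := by
  rw [annulusIntegrand, radialCutoff_coe, norm_eq_of_mem_sphere x, radialExtension_coe]
  norm_num

/-- The integral over the sphere up to a constant factor, as a weighted integral of the radial
extension over an annulus. -/
noncomputable def sphereIntegral (d : ℕ) (f : RoundSphere d → ℝ) : ℝ :=
  ∫ y, annulusIntegrand d f y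

theorem sphereIntegral_add {d : ℕ} {f g : RoundSphere d → ℝ} (hf : Continuous f)
    (hg : Continuous g) : sphereIntegral d (f + g) = sphereIntegral d f + sphereIntegral d g := by
  rw [sphereIntegral, sphereIntegral, sphereIntegral,
    ← integral_add (annulusIntegrand_integrable hf) (annulusIntegrand_integrable hg)]
  congr 1
  funext y
  rw [annulusIntegrand, radialExtension_add, Pi.add_apply, annulusIntegrand, annulusIntegrand]
  ring

theorem sphereIntegral_smul {d : ℕ} (c : ℝ) (f : RoundSphere d → ℝ) :
    sphereIntegral d (c • f) = c * sphereIntegral d f := by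
  rw [sphereIntegral, sphereIntegral, ← integral_const_mul]
  congr 1
  funext y
  rw [annulusIntegrand, radialExtension_smul, Pi.smul_apply, annulusIntegrand, smul_eq_mul]
  ring

theorem sphereIntegral_mono {d : ℕ} {f g : RoundSphere d → ℝ} (hf : Continuous f)
    (hg : Continuous g) (h : ∀ x, f x ≤ g x) : sphereIntegral d f ≤ sphereIntegral d g := by
  refine integral_mono (annulusIntegrand_integrable hf) (annulusIntegrand_integrable hg) fun y => ?_
  rcases eq_or_ne y 0 with rfl | hy
  · simp [annulusIntegrand, radialExtension]
  · simp only [annulusIntegrand]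
    rw [← mul_assoc, ← mul_assoc, ← mul_assoc, ← mul_assoc]
    refine mul_le_mul_of_nonneg_left ?_
      (mul_nonneg (mul_self_nonneg _) (by positivity))
    rw [radialExtension_of_ne_zero _ hy, radialExtension_of_ne_zero _ hy]
    exact h _

theorem eq_zero_of_sphereIntegral_mul_self {d : ℕ} {f : RoundSphere d → ℝ} (hf : Continuous f)
    (h : sphereIntegral d (f * f) = 0) : f = 0 := by
  by_contra hne
  obtain ⟨x, hx⟩ := Function.ne_iff.mp hne
  refine (Continuous.integral_pos_of_hasCompactSupport_nonneg_nonzero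
    (annulusIntegrand_continuous (hf.mul hf)) (annulusIntegrand_hasCompactSupport _)
    (fun y => ?_) (x := (x : AmbientSpace d)) ?_).ne' h
  · simp only [annulusIntegrand, Pi.zero_apply, radialExtension_mul]
    nlinarith [mul_self_nonneg (radialCutoff d y * ‖y‖⁻¹ * radialExtension d f y)]
  · rw [annulusIntegrand_coe]
    exact mul_self_ne_zero.mpr hx

/-- Eigenfunctions for different eigenvalues are orthogonal. For a radial cutoff `φ` and the radial
extensions `F`, `G` one has `Δ (φ F) = F Δφ + φ ΔF`, so that symmetry of the Euclidean Laplacian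
on `φ F` and `φ G` gives `∫ φ² (F ΔG - G ΔF) = 0`. -/
theorem sphereIntegral_mul_eq_zero {d : ℕ} {f g : RoundSphere d → ℝ} {μ ν : ℝ} (hμν : μ ≠ ν)
    (hf : f ∈ laplaceEigenspace d μ) (hg : g ∈ laplaceEigenspace d ν) :
    sphereIntegral d (f * g) = 0 := by
  have hsmooth : ∀ {h : RoundSphere d → ℝ} {κ : ℝ}, h ∈ laplaceEigenspace d κ →
      ContDiff ℝ ∞ fun y => radialCutoff d y * radialExtension d h y := fun hh =>
    contDiff_radialCutoff_mul fun y hy => radialExtension_contDiffAt d hh.1 hy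
  have hsupp : ∀ h : RoundSphere d → ℝ,
      HasCompactSupport fun y => radialCutoff d y * radialExtension d h y := fun h =>
    (radialCutoff_hasCompactSupport d).mul_right
  have hΔ : ∀ {h : RoundSphere d → ℝ} {κ : ℝ}, h ∈ laplaceEigenspace d κ →
      ∀ y : AmbientSpace d, y ≠ 0 → Δ (fun y => radialCutoff d y * radialExtension d h y) y =
        radialCutoff d y * (-(κ * ‖y‖⁻¹ ^ 2) * radialExtension d h y) +
          radialExtension d h y * Δ (radialCutoff d) y := by
    intro h κ hh y hy
    have hF := radialExtension_contDiffAt d hh.1 hy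
    have h1 := laplacian_radial_mul (x := y) (ρ := annulusBump)
      annulusBump.contDiff.contDiffAt (hF.of_le (m := 2) (by norm_cast))
    rw [fderiv_apply_self_of_forall_smul (hF.differentiableAt (by norm_num))
      (fun c hc => radialExtension_smul_of_pos h hc y), laplacian_radialExtension hh hy, mul_zero,
      add_zero] at h1
    exact h1
  let u := (hsupp f).toSchwartzMap (hsmooth hf)
  let v := (hsupp g).toSchwartzMap (hsmooth hg)
  have key : ∫ y, u y * Δ v y = ∫ y, Δ u y * v y :=
    SchwartzMap.integral_mul_laplacian_right_eq_left u v
  have hpt : ∀ y, u y * Δ v y = Δ u y * v y + (μ - ν) * annulusIntegrand d (f * g) y := by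
    intro y
    rcases eq_or_ne y 0 with rfl | hy
    · have hu : u 0 = 0 := by simp [u, radialExtension]
      have hv : v 0 = 0 := by simp [v, radialExtension]
      simp [hu, hv, annulusIntegrand, radialExtension]
    · rw [SchwartzMap.laplacian_apply, SchwartzMap.laplacian_apply]
      have h1 := hΔ hf y hy
      have h2 := hΔ hg y hy
      have hu : (u : AmbientSpace d → ℝ) = fun y => radialCutoff d y * radialExtension d f y := rfl
      have hv : (v : AmbientSpace d → ℝ) = fun y => radialCutoff d y * radialExtension d g y := rfl
      rw [hu, hv, h1, h2, annulusIntegrand, radialExtension_mul]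
      ring
  have hint : Integrable fun y => Δ u y * v y :=
    ((Δ u).continuous.mul v.continuous).integrable_of_hasCompactSupport
      (hsupp g).mul_left
  rw [integral_congr_ae (Eventually.of_forall hpt), integral_add hint
    ((annulusIntegrand_integrable (hf.1.continuous.mul hg.1.continuous)).const_mul _),
    integral_const_mul] at key
  have h0 : (μ - ν) * sphereIntegral d (f * g) = 0 := by
    rw [sphereIntegral]
    linarith
  exact (mul_eq_zero.mp h0).resolve_left (sub_ne_zero.mpr hμν)

/-! ### Completeness of the spherical harmonics -/

/-- The coordinate functions on the sphere. -/
def sphereCoord (d : ℕ) (i : Fin (d + 1)) : C(RoundSphere d, ℝ) where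
  toFun x := (x : AmbientSpace d) i
  continuous_toFun := by fun_prop

theorem aeval_sphereCoord {d : ℕ} (p : MvPolynomial (Fin (d + 1)) ℝ) :
    ⇑(MvPolynomial.aeval (sphereCoord d) p) = restrictSphere d p := by
  funext x
  induction p using MvPolynomial.induction_on with
  | C a => simp [restrictSphere_apply]
  | add p q hp hq => rw [map_add, map_add, ContinuousMap.add_apply, hp, hq, Pi.add_apply]
  | mul_X p j hp =>
    rw [map_mul, ContinuousMap.mul_apply, hp, MvPolynomial.aeval_X, restrictSphere_apply,
      restrictSphere_apply, map_mul, MvPolynomial.eval_X]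
    rfl

theorem separatesPoints_aeval_sphereCoord (d : ℕ) :
    (MvPolynomial.aeval (R := ℝ) (sphereCoord d)).range.SeparatesPoints := by
  intro x y hxy
  have : ∃ i, (x : AmbientSpace d) i ≠ (y : AmbientSpace d) i := by
    by_contra! hcon
    exact hxy (Subtype.ext (PiLp.ext hcon))
  obtain ⟨i, hi⟩ := this
  refine ⟨restrictSphere d (MvPolynomial.X i), ⟨MvPolynomial.aeval (sphereCoord d)
    (MvPolynomial.X i), ⟨MvPolynomial.X i, rfl⟩, aeval_sphereCoord _⟩, ?_⟩
  simpa only [restrictSphere_apply, MvPolynomial.eval_X] using hi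

/-- By the Stone–Weierstrass theorem, polynomials are uniformly dense in the continuous functions
on the sphere. -/
theorem exists_restrictSphere_near {d : ℕ} {f : RoundSphere d → ℝ} (hf : Continuous f) {ε : ℝ}
    (hε : 0 < ε) : ∃ p, ∀ x, |f x - restrictSphere d p x| ≤ ε := by
  obtain ⟨g, hg⟩ := ContinuousMap.exists_mem_subalgebra_near_continuous_of_separatesPoints _
    (separatesPoints_aeval_sphereCoord d) f hf ε hε
  obtain ⟨p, hp⟩ := g.2
  refine ⟨p, fun x => ?_⟩
  have h1 := (hg x).le
  rw [Real.norm_eq_abs, abs_sub_comm] at h1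
  have h2 : (g : C(RoundSphere d, ℝ)) x = restrictSphere d p x := by
    rw [← aeval_sphereCoord, ← hp]
    rfl
  rwa [h2] at h1

/-- A continuous function orthogonal to all polynomials vanishes. -/
theorem eq_zero_of_forall_sphereIntegral_restrictSphere {d : ℕ} {f : RoundSphere d → ℝ}
    (hf : Continuous f) (h : ∀ p, sphereIntegral d (f * restrictSphere d p) = 0) : f = 0 := by
  refine eq_zero_of_sphereIntegral_mul_self hf (le_antisymm ?_ ?_)
  · -- `∫ f² = ∫ f (f - p) ≤ ε ∫ |f|` for a polynomial `p` within `ε` of `f`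
    have hle : ∀ ε : ℝ, 0 < ε →
        sphereIntegral d (f * f) ≤ ε * sphereIntegral d (fun x => |f x|) := by
      intro ε hε
      obtain ⟨p, hp⟩ := exists_restrictSphere_near hf hε
      have hpc : Continuous (restrictSphere d p) := (contMDiff_restrictSphere p).continuous
      have hsplit : f * f = f * (f - restrictSphere d p) + f * restrictSphere d p := by ring
      rw [hsplit, sphereIntegral_add (hf.mul (hf.sub hpc)) (hf.mul hpc), h p, add_zero,
        ← sphereIntegral_smul]
      refine sphereIntegral_mono (hf.mul (hf.sub hpc)) (hf.abs.const_smul ε) fun x => ?_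
      calc f x * (f x - restrictSphere d p x) ≤ |f x| * |f x - restrictSphere d p x| := by
            rw [← abs_mul]; exact le_abs_self _
        _ ≤ |f x| * ε := mul_le_mul_of_nonneg_left (hp x) (abs_nonneg _)
        _ = ε • |f x| := by rw [smul_eq_mul, mul_comm]
    have ht : Tendsto (fun ε : ℝ => ε * sphereIntegral d (fun x => |f x|)) (𝓝[>] 0) (𝓝 0) := by
      have : Tendsto (fun ε : ℝ => ε * sphereIntegral d (fun x => |f x|)) (𝓝 0)
          (𝓝 (0 * sphereIntegral d (fun x => |f x|))) := tendsto_id.mul_const _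
      rw [zero_mul] at this
      exact this.mono_left nhdsWithin_le_nhds
    exact ge_of_tendsto ht (eventually_mem_nhdsWithin.mono hle)
  · have h0 := sphereIntegral_mono (d := d) (f := 0) continuous_zero (hf.mul hf) fun x =>
      mul_self_nonneg (f x)
    have h1 := sphereIntegral_smul (d := d) 0 0
    rw [zero_smul, zero_mul] at h1
    rwa [h1] at h0

/-- A continuous function orthogonal to all spherical harmonics vanishes. -/
theorem eq_zero_of_forall_sphereIntegral_harmonic {d : ℕ} {f : RoundSphere d → ℝ}
    (hf : Continuous f) (h : ∀ l, ∀ p ∈ harmonicSubmodule (Fin (d + 1)) l,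
      sphereIntegral d (f * restrictSphere d p) = 0) : f = 0 := by
  have hc : ∀ p, Continuous (restrictSphere d p) := fun p => (contMDiff_restrictSphere p).continuous
  let V : Submodule ℝ (MvPolynomial (Fin (d + 1)) ℝ) :=
    { carrier := {p | sphereIntegral d (f * restrictSphere d p) = 0}
      zero_mem' := h 0 0 (zero_mem _)
      add_mem' := fun {p q} hp hq => by
        have hp' : sphereIntegral d (f * restrictSphere d p) = 0 := hp
        have hq' : sphereIntegral d (f * restrictSphere d q) = 0 := hq
        change sphereIntegral d (f * restrictSphere d (p + q)) = 0
        rw [map_add, mul_add, sphereIntegral_add (hf.mul (hc p)) (hf.mul (hc q)), hp', hq',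
          add_zero]
      smul_mem' := fun c p hp => by
        have hp' : sphereIntegral d (f * restrictSphere d p) = 0 := hp
        change sphereIntegral d (f * restrictSphere d (c • p)) = 0
        rw [map_smul, mul_smul_comm, sphereIntegral_smul, hp', mul_zero] }
  refine eq_zero_of_forall_sphereIntegral_restrictSphere hf fun p =>
    mem_of_harmonicSubmodule_le (V := V) (fun l p hp => h l p hp) (fun q hq => ?_) p
  have hq' : sphereIntegral d (f * restrictSphere d q) = 0 := hq
  have hone : restrictSphere d (normSqPoly (Fin (d + 1)) * q) = restrictSphere d q := by
    funext x
    have hx := EuclideanSpace.real_norm_sq_eq (x : AmbientSpace d)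
    rw [norm_eq_of_mem_sphere x, one_pow] at hx
    have : MvPolynomial.eval (fun i => (x : AmbientSpace d) i) (normSqPoly (Fin (d + 1))) = 1 := by
      simp [normSqPoly, hx, pow_two]
    rw [restrictSphere_apply, restrictSphere_apply, map_mul, this, one_mul]
  change sphereIntegral d (f * restrictSphere d (normSqPoly (Fin (d + 1)) * q)) = 0
  rw [hone, hq']

theorem laplaceEigenspace_eq_bot {d : ℕ} {μ : ℝ} (hμ : μ ∉ Set.range (energyLevel d)) :
    laplaceEigenspace d μ = ⊥ := by
  refine (Submodule.eq_bot_iff _).mpr fun f hf =>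
    eq_zero_of_forall_sphereIntegral_harmonic hf.1.continuous fun l p hp =>
      sphereIntegral_mul_eq_zero ?_ hf (restrictSphere_mem_laplaceEigenspace hp)
  rintro rfl
  exact hμ ⟨l, rfl⟩

/-- The inner product of continuous functions on the sphere, up to a constant factor. -/
noncomputable def sphereForm (d : ℕ) : C(RoundSphere d, ℝ) →ₗ[ℝ] C(RoundSphere d, ℝ) →ₗ[ℝ] ℝ :=
  LinearMap.mk₂ ℝ (fun f g => sphereIntegral d (⇑f * ⇑g))
    (fun f f' g => by
      rw [ContinuousMap.coe_add, add_mul,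
        sphereIntegral_add (f.continuous.mul g.continuous) (f'.continuous.mul g.continuous)])
    (fun c f g => by
      rw [ContinuousMap.coe_smul, smul_mul_assoc, sphereIntegral_smul, smul_eq_mul])
    (fun f g g' => by
      rw [ContinuousMap.coe_add, mul_add,
        sphereIntegral_add (f.continuous.mul g.continuous) (f.continuous.mul g'.continuous)])
    (fun c f g => by
      rw [ContinuousMap.coe_smul, mul_smul_comm, sphereIntegral_smul, smul_eq_mul])

theorem sphereForm_apply {d : ℕ} (f g : C(RoundSphere d, ℝ)) :
    sphereForm d f g = sphereIntegral d (⇑f * ⇑g) := rfl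

/-- The restriction of homogeneous harmonic polynomials to the sphere, as continuous functions. -/
noncomputable def restrictHarmonic (d l : ℕ) :
    harmonicSubmodule (Fin (d + 1)) l →ₗ[ℝ] C(RoundSphere d, ℝ) :=
  (MvPolynomial.aeval (sphereCoord d)).toLinearMap ∘ₗ (harmonicSubmodule (Fin (d + 1)) l).subtype

theorem coe_restrictHarmonic {d l : ℕ} (q : harmonicSubmodule (Fin (d + 1)) l) :
    ⇑(restrictHarmonic d l q) = restrictSphere d q := aeval_sphereCoord _

theorem sphereForm_restrictHarmonic_injective (d l : ℕ) :
    Function.Injective ((sphereForm d).compl₁₂ (restrictHarmonic d l) (restrictHarmonic d l)) := by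
  refine (injective_iff_map_eq_zero _).mpr fun q hq => Subtype.ext ?_
  have h0 : sphereForm d (restrictHarmonic d l q) (restrictHarmonic d l q) = 0 :=
    DFunLike.congr_fun hq q
  rw [sphereForm_apply, coe_restrictHarmonic] at h0
  exact restrictSphere_injOn (mem_harmonicSubmodule.mp q.2).1
    (eq_zero_of_sphereIntegral_mul_self (contMDiff_restrictSphere _).continuous h0)

/-- The orthogonal projection of a continuous function onto the spherical harmonics of degree `l`
exists, since these form a finite-dimensional space on which the inner product is definite. -/
theorem exists_projection_harmonic {d : ℕ} (f : C(RoundSphere d, ℝ)) (l : ℕ) :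
    ∃ q ∈ harmonicSubmodule (Fin (d + 1)) l, ∀ p ∈ harmonicSubmodule (Fin (d + 1)) l,
      sphereIntegral d (restrictSphere d q * restrictSphere d p) =
        sphereIntegral d (f * restrictSphere d p) := by
  have hfr : Module.finrank ℝ (harmonicSubmodule (Fin (d + 1)) l) =
      Module.finrank ℝ (Module.Dual ℝ (harmonicSubmodule (Fin (d + 1)) l)) :=
    Subspace.dual_finrank_eq.symm
  obtain ⟨⟨q, hqmem⟩, hq⟩ := (LinearMap.injective_iff_surjective_of_finrank_eq_finrank hfr).mp
    (sphereForm_restrictHarmonic_injective d l) (sphereForm d f ∘ₗ restrictHarmonic d l)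
  refine ⟨q, hqmem, fun p hp => ?_⟩
  have h1 := LinearMap.congr_fun hq ⟨p, hp⟩
  rw [LinearMap.compl₁₂_apply, LinearMap.comp_apply, sphereForm_apply, sphereForm_apply,
    coe_restrictHarmonic, coe_restrictHarmonic] at h1
  exact h1

/-- The eigenfunctions for the energy level `l` are the spherical harmonics of degree `l`: after
subtraction of its orthogonal projection onto these, an eigenfunction is orthogonal to the spherical
harmonics of all degrees. -/
theorem laplaceEigenspace_energyLevel {d : ℕ} (hd : 1 ≤ d) (l : ℕ) :
    laplaceEigenspace d (energyLevel d l) =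
      (harmonicSubmodule (Fin (d + 1)) l).map (restrictSphere d) := by
  have hc : ∀ p, Continuous (restrictSphere d p) := fun p => (contMDiff_restrictSphere p).continuous
  refine le_antisymm (fun f hf => ?_) (Submodule.map_le_iff_le_comap.mpr fun p hp =>
    restrictSphere_mem_laplaceEigenspace hp)
  obtain ⟨q, hq, hproj⟩ := exists_projection_harmonic ⟨f, hf.1.continuous⟩ l
  have hsub : f - restrictSphere d q ∈ laplaceEigenspace d (energyLevel d l) :=
    Submodule.sub_mem _ hf (restrictSphere_mem_laplaceEigenspace hq)
  refine ⟨q, hq, (sub_eq_zero.mp ?_).symm⟩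
  refine eq_zero_of_forall_sphereIntegral_harmonic hsub.1.continuous fun k p hp => ?_
  rcases eq_or_ne k l with rfl | hkl
  · have h1 : sphereIntegral d (restrictSphere d q * restrictSphere d p) =
        sphereIntegral d (f * restrictSphere d p) := hproj p hp
    have h2 : f * restrictSphere d p = (f - restrictSphere d q) * restrictSphere d p +
        restrictSphere d q * restrictSphere d p := by ring
    rw [h2, sphereIntegral_add (hsub.1.continuous.mul (hc p)) ((hc q).mul (hc p))] at h1
    linarith
  · exact sphereIntegral_mul_eq_zero (fun h => hkl ((energyLevel_strictMono hd).injective h).symm)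
      hsub (restrictSphere_mem_laplaceEigenspace hp)

theorem toENat_rank_laplaceEigenspace {d : ℕ} (hd : 1 ≤ d) (l : ℕ) :
    Cardinal.toENat (Module.rank ℝ (laplaceEigenspace d (energyLevel d l))) =
      Module.finrank ℝ (harmonicSubmodule (Fin (d + 1)) l) := by
  have hinj : Function.Injective
      ((restrictSphere d).domRestrict (harmonicSubmodule (Fin (d + 1)) l)) := by
    refine (injective_iff_map_eq_zero _).mpr fun q hq => Subtype.ext ?_
    exact restrictSphere_injOn (mem_harmonicSubmodule.mp q.2).1 hq
  rw [laplaceEigenspace_energyLevel hd, ← LinearMap.range_domRestrict,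
    rank_range_of_injective _ hinj, ← Module.finrank_eq_rank, Cardinal.toENat_nat]

/-- The spectrum is the list of the energy levels with the multiplicities `dim H_l`. -/
theorem isLaplaceSpectrum_iff {d : ℕ} (hd : 1 ≤ d) (lam : ℕ → ℝ) :
    IsLaplaceSpectrum d lam ↔ ListsEnergyLevels d
      (fun l => Module.finrank ℝ (harmonicSubmodule (Fin (d + 1)) l)) lam := by
  constructor
  · intro h
    refine ⟨h.monotone, fun j => ?_, fun l => ?_⟩
    · by_contra hj
      have h1 := h.multiplicity (lam j)
      rw [laplaceEigenspace_eq_bot hj, rank_bot, map_zero, Set.encard_eq_zero] at h1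
      exact Set.notMem_empty j (h1 ▸ (rfl : lam j = lam j))
    · rw [h.multiplicity, toENat_rank_laplaceEigenspace hd]
  · intro h
    refine ⟨h.monotone, h.tendsto hd (sum_finrank_harmonicSubmodule hd), fun μ => ?_⟩
    by_cases hμ : μ ∈ Set.range (energyLevel d)
    · obtain ⟨l, rfl⟩ := hμ
      rw [h.encard, toENat_rank_laplaceEigenspace hd]
    · rw [laplaceEigenspace_eq_bot hμ, rank_bot, map_zero, Set.encard_eq_zero]
      refine Set.eq_empty_of_forall_notMem fun j hj => hμ ?_
      have hj' : lam j = μ := hj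
      exact hj' ▸ h.mem_range j

/-! ### Riesz means and eigenvalue averages on the sphere -/

theorem mainTheorem2 (d : ℕ) (hd : 1 ≤ d) :
    (∃ lam : ℕ → ℝ, IsLaplaceSpectrum d lam) ∧
    ∀ lam : ℕ → ℝ, IsLaplaceSpectrum d lam →
      -- the upper bound for the first Riesz mean
      (∀ z : ℝ, 0 ≤ z → rieszMean lam z ≤ shiftedWeylTerm d (shiftConst d) z) ∧
      -- the lower bound for the eigenvalue averages
      (∀ k : ℕ, 1 ≤ k →
        berezinLiYauTerm d k - shiftConst d ≤ eigenvalueAverage lam k) ∧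
      -- the two families of inequalities are equivalent, for every shift
      (∀ b : ℝ, 0 ≤ b →
        ((∀ z : ℝ, 0 ≤ z → rieszMean lam z ≤ shiftedWeylTerm d b z) ↔
          (∀ k : ℕ, 1 ≤ k → berezinLiYauTerm d k - b ≤ eigenvalueAverage lam k))) ∧
      -- asymptotic optimality: the distinct eigenvalues are the energy levels, the best shift
      -- between consecutive energy levels tends to the shift of the theorem, and no smaller
      -- shift is admissible for all large `z`
      (Set.range lam = Set.range (energyLevel d) ∧
        (∃ bopt : ℕ → ℝ,
          (∀ l : ℕ, IsLeast {b : ℝ | 0 ≤ b ∧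
              ∀ z ∈ Set.Icc (energyLevel d l) (energyLevel d (l + 1)),
                rieszMean lam z ≤ shiftedWeylTerm d b z} (bopt l)) ∧
          Tendsto bopt atTop (𝓝 (shiftConst d))) ∧
        ∀ b : ℝ, b < shiftConst d →
          ∃ᶠ z : ℝ in atTop, shiftedWeylTerm d b z < rieszMean lam z) := by
  have hm := sum_finrank_harmonicSubmodule hd
  refine ⟨?_, fun lam hlam => ?_⟩
  · obtain ⟨lam, hlam⟩ := exists_listsEnergyLevels hd hm
    exact ⟨lam, (isLaplaceSpectrum_iff hd lam).mpr hlam⟩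
  have hL := (isLaplaceSpectrum_iff hd lam).mp hlam
  have hnn : ∀ j, 0 ≤ lam j := fun j => by
    obtain ⟨k, hk⟩ := hL.mem_range j
    exact hk ▸ energyLevel_nonneg hd k
  have hequiv := fun (b : ℝ) (hb : 0 ≤ b) =>
    rieszMean_le_iff_le_eigenvalueAverage hd hlam.monotone hlam.tendsto hnn hb
  have hriesz : ∀ z : ℝ, 0 ≤ z → rieszMean lam z ≤ shiftedWeylTerm d (shiftConst d) z :=
    fun z hz => hL.rieszMean_le_shiftConst hd hm hz
  have hshift : 0 ≤ shiftConst d := (optimalShift_nonneg hd 0).trans (optimalShift_le hd 0)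
  exact ⟨hriesz, (hequiv _ hshift).mp hriesz, hequiv, hL.range_eq hd hm,
    ⟨optimalShift d, hL.isLeast_optimalShift hd hm, optimalShift_tendsto hd⟩,
    fun b hb => hL.frequently_lt_rieszMean hd hm hb⟩
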